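/- Let $\mathbb{T}^3=\mathbb{R}^3/\mathbb{Z}^3$, let $T>0$ and $\theta\in(0,\tfrac13)$. Let $v\in L^3((0,T);C^\theta(\mathbb{T}^3;\mathbb{R}^3))\cap C^0([0,T];L^2(\mathbb{T}^3;\mathbb{R}^3))$ be a weak solution of the incompressible Euler equations $\partial_t v+\operatorname{div}(v\otimes v)+\nabla p=0$, $\operatorname{div}v=0$, that is, $v\in L^2(\mathbb{T}^3\times[0,T])$, $$\int_0^T\!\!\int_{\mathbb{T}^3}\bigl(v\cdot\partial_t\varphi+v\otimes v:\nabla\varphi\bigr)\,dx\,dt=0\quad\text{for all }\varphi\in C_c^\infty(\mathbb{T}^3\times(0,T);\mathbb{R}^3)\text{ with }\operatorname{div}\varphi=0,$$ and $\int_0^T\int_{\mathbb{T}^3}v\cdot\nabla q\,dx\,dt=0$ for all $q\in C_c^\infty(\mathbb{T}^3\times(0,T))$. Here $v\in L^3((0,T);C^\theta)$ means that $t\mapsto\|v(\cdot,t)\|_{C^\theta}$ belongs to $L^3((0,T))$, where $\|f\|_{C^\theta}=\sup|f|+\sup_{x\ne y}|f(x)-f(y)|/|x-y|^\theta$. Suppose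 that $v$ is non-conservative: the kinetic energy $e_v(t)=\tfrac12\int_{\mathbb{T}^3}|v(x,t)|^2\,dx$ is not constant on $[0,T]$. Let $\{S_t\}_{t\in[0,T]}$ be a family of subsets of $\mathbb{T}^3$, $C\in L^3((0,T))$ and $\kappa\in\mathbb{R}$ with $\kappa\le 1-\theta$, such that for almost every $t\in[0,T]$ the set $S_t$ is closed, $v(\cdot,t)\in C^1(\mathbb{T}^3\setminus S_t)$, and $$|\nabla v(x,t)|\le C(t)\,\operatorname{dist}(x,S_t)^{-\kappa}\qquad\text{for all }x\in\mathbb{T}^3\setminus S_t,$$ with the convention $\operatorname{dist}(x,\emptyset)=1$. Then $$\overline{\dim}_{\mathcal{M}_\infty}\bigl(\{S_t\}_{t\in[0,T]}\bigr)\ \ge\ 2+3\theta,$$ where the uniform-in-time upper Minkowski dimension is $$\overline{\dim}_{\mathcal{M}_\infty}(\{S_t\}):=\inf\Bigl\{s\ge0:\ \limsup_{\varepsilon\downarrow0}\ \operatorname*{ess\,sup}_{t\in[0,T]}\,(2\varepsilon)^{s-3}\,\mathcal{H}^3\bigl((S_t)_\varepsilon\bigr)=0\Bigr\},\qquad (S_t)_\varepsilon=\{x\in\mathbb{T}^3:\operatorname{dist}(x,S_t)\le\varepsilon\}.$$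 -/

import Mathlib

open Set Filter Topology MeasureTheory
open scoped ENNReal NNReal

noncomputable section

namespace EulerTorus

/-- Euclidean three-space. The torus `𝕋³ = ℝ³ / ℤ³` is handled through periodic objects on it. -/
abbrev E3 : Type := EuclideanSpace ℝ (Fin 3)

/-- The vector of the lattice `ℤ³` with integer coordinates `k`. -/
def latticeVec (k : Fin 3 → ℤ) : E3 := WithLp.toLp 2 (fun i => (k i : ℝ))

/-- `ℤ³`-periodicity: `f` is the periodic extension of a function on `𝕋³`. -/
def IsPeriodic {β : Type*} (f : E3 → β) : Prop :=
  ∀ (x : E3) (k : Fin 3 → ℤ), f (x + latticeVec k) = f x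

/-- The periodic subsets of `ℝ³` are the preimages of the subsets of `𝕋³`. -/
def IsPeriodicSet (S : Set E3) : Prop :=
  ∀ (x : E3) (k : Fin 3 → ℤ), x + latticeVec k ∈ S ↔ x ∈ S

/-- The fundamental cell `[0,1)³`. -/
def unitCell : Set E3 := {x | ∀ i, x i ∈ Ico (0 : ℝ) 1}

/-- Lebesgue measure (three-dimensional Hausdorff measure) of the torus, carried by the cell. -/
def torusMeasure : Measure E3 := volume.restrict unitCell

/-- The distance to a closed set, with the convention `dist(x, ∅) = 1`. For a periodic nonempty `S`
this is the distance of the quotient metric on `𝕋³`. -/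
def distTo (x : E3) (S : Set E3) : ℝ :=
  open Classical in if S = ∅ then 1 else Metric.infDist x S

/-- Smooth test functions with compact support in `𝕋³ × (0,T)`. -/
structure IsTestFunction {F : Type*} [NormedAddCommGroup F] [NormedSpace ℝ F]
    (T : ℝ) (φ : ℝ → E3 → F) : Prop where
  smooth : ContDiff ℝ ((⊤ : ℕ∞) : WithTop ℕ∞) (fun z : ℝ × E3 => φ z.1 z.2)
  periodic : ∀ t, IsPeriodic (φ t)
  compactSupport : ∃ a b : ℝ, 0 < a ∧ b < T ∧ ∀ t, t ∉ Icc a b → ∀ x, φ t x = 0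

/-- The divergence of a vector field on `ℝ³`. -/
def divergence (f : E3 → E3) (x : E3) : ℝ :=
  ∑ i, (fderiv ℝ f x (EuclideanSpace.single i 1)) i

/-- `v` is a weak solution of the incompressible Euler equations on `𝕋³ × [0,T]`: it is a square
integrable (periodic) field, the momentum equation
`∂ₜ v + div (v ⊗ v) + ∇ p = 0` holds against divergence free test fields, where
`v ⊗ v : ∇φ = v · (Dφ v)`, and `div v = 0` holds in the sense of distributions. -/
structure IsWeakEulerSolution (T : ℝ) (v : ℝ → E3 → E3) : Prop where
  periodic : ∀ t ∈ Icc 0 T, IsPeriodic (v t)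
  memLp : MemLp (fun z : ℝ × E3 => v z.1 z.2) 2
    ((volume.restrict (Icc 0 T)).prod torusMeasure)
  momentum : ∀ φ : ℝ → E3 → E3, IsTestFunction T φ → (∀ t x, divergence (φ t) x = 0) →
    ∫ t in Icc 0 T, ∫ x, (inner ℝ (v t x) (deriv (fun s => φ s x) t)
      + inner ℝ (v t x) (fderiv ℝ (φ t) x (v t x))) ∂torusMeasure = 0
  divFree : ∀ q : ℝ → E3 → ℝ, IsTestFunction T q →
    ∫ t in Icc 0 T, ∫ x, fderiv ℝ (q t) x (v t x) ∂torusMeasure = 0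

/-- The Hölder norm `‖f‖_{C^θ} = sup |f| + [f]_{C^θ}`, infinite if `f` is not in `C^θ`. -/
def holderENorm (θ : ℝ) (f : E3 → E3) : ℝ≥0∞ :=
  (⨆ x, ‖f x‖ₑ) + eHolderNorm θ.toNNReal f

/-- `v ∈ L³((0,T); C^θ(𝕋³))`, as the integrability of `t ↦ ‖v(t)‖_{C^θ}` to the third power. -/
def MemL3Holder (T θ : ℝ) (v : ℝ → E3 → E3) : Prop :=
  MemLp (fun t => holderENorm θ (v t)) 3 (volume.restrict (Ioo 0 T))

/-- `v ∈ C⁰([0,T]; L²(𝕋³))`. -/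
def MemC0L2 (T : ℝ) (v : ℝ → E3 → E3) : Prop :=
  ∀ t ∈ Icc 0 T, MemLp (v t) 2 torusMeasure ∧
    Tendsto (fun s => eLpNorm (v s - v t) 2 torusMeasure) (𝓝[Icc 0 T] t) (𝓝 0)

/-- The kinetic energy `e_v(t) = ½ ∫ |v(x,t)|² dx`. -/
def kineticEnergy (v : ℝ → E3 → E3) (t : ℝ) : ℝ :=
  1 / 2 * ∫ x, ‖v t x‖ ^ 2 ∂torusMeasure

/-- `v` is conservative: its kinetic energy is constant on `[0,T]`. -/
def IsConservative (T : ℝ) (v : ℝ → E3 → E3) : Prop :=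
  ∀ t ∈ Icc 0 T, kineticEnergy v t = kineticEnergy v 0

/-- The uniform-in-time upper Minkowski content
`limsup_{ε ↓ 0} esssup_{t ∈ [0,T]} (2ε)^{s-3} |(S_t)_ε|`, with `(S_t)_ε` the closed
`ε`-neighbourhood of `S_t` in the torus. -/
def uniformMinkowskiContent (T s : ℝ) (S : ℝ → Set E3) : ℝ≥0∞ :=
  limsup (fun ε : ℝ =>
    essSup (fun t => ENNReal.ofReal ((2 * ε) ^ (s - 3)) *
      torusMeasure (Metric.cthickening ε (S t))) (volume.restrict (Icc 0 T))) (𝓝[>] 0)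

/-- The uniform-in-time upper Minkowski dimension: the infimum of all `s ≥ 0` for which the
uniform-in-time upper Minkowski content vanishes. -/
def uniformMinkowskiDim (T : ℝ) (S : ℝ → Set E3) : ℝ≥0∞ :=
  ⨅ (s : ℝ≥0) (_ : uniformMinkowskiContent T s S = 0), (s : ℝ≥0∞)

end EulerTorus

end

open EulerTorus

open scoped Pointwise

/-! ### The cell, the lattice and periodic functions -/

/-! By contraposition: if the content vanishes for some `s < 2 + 3θ`, the energy is conserved. Pair
`v` with its mollification at scale `r`. This mollified energy has as time derivative twice a flux,
and by incompressibility the flux is `-1/4 ∬ ∇ρ(y - x)·δv |δv|²` with `δv = v(y) - v(x)`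
(`IsMollifier.integral_flux_eq`).

Let `d` be the distance of `x` to `S_t`. If `r ≤ d/2`, the gradient bound gives `|δv| ≲ d^(θ-1) r`,
so the inner integral is `O(d^(3θ-3) r²)`, which tends to zero for fixed `x`. If `r > d/2`, the
Hölder bound gives `O(r^(3θ-1))`. In both regimes the inner integral is at most a constant times
`(d/2)^(-(1-3θ))`, independently of `r` (`IsMollifier.cubicIncrement_le_rpow`).

This majorant is integrable in `x`, uniformly in `t`, because the neighbourhoods of `S_t` of radius
`ε` have measure `O(ε^(3-s))` and `3 - s > 1 - 3θ` (`exists_lintegral_distTo_rpow_le`). In time it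
carries the cube of an `L³` function. Dominated convergence in `x`, then in `t`, makes the flux
vanish in `L¹(0,T)` (`IsEulerCurve.energy_eq_of_isRegularOff`). The energy is therefore constant
almost everywhere, and everywhere by continuity in `L²`. -/

lemma latticeVec_apply (k : Fin 3 → ℤ) (i : Fin 3) : latticeVec k i = (k i : ℝ) := rfl

lemma latticeVec_neg (k : Fin 3 → ℤ) : latticeVec (-k) = -latticeVec k := by
  ext i; simp [latticeVec_apply]

lemma EulerTorus.IsPeriodic.sub_latticeVec {β : Type*} {f : E3 → β} (hf : IsPeriodic f) (x : E3)
    (k : Fin 3 → ℤ) : f (x - latticeVec k) = f x := by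
  rw [sub_eq_add_neg, ← latticeVec_neg, hf]

lemma unitCell_eq_fundamentalDomain :
    unitCell = ZSpan.fundamentalDomain (EuclideanSpace.basisFun (Fin 3) ℝ).toBasis := by
  ext x
  simp [unitCell, ZSpan.mem_fundamentalDomain]

lemma measurableSet_unitCell : MeasurableSet unitCell := by
  rw [unitCell_eq_fundamentalDomain]
  exact ZSpan.fundamentalDomain_measurableSet _

lemma exists_latticeVec_eq
    (g : Submodule.span ℤ (Set.range (EuclideanSpace.basisFun (Fin 3) ℝ).toBasis)) :
    ∃ k, (g : E3) = latticeVec k := by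
  have h := g.2
  rw [Module.Basis.mem_span_iff_repr_mem] at h
  choose k hk using h
  refine ⟨k, ?_⟩
  ext i
  have := hk i
  simp at this
  rw [latticeVec_apply, this]

lemma isAddFundamentalDomain_unitCell :
    IsAddFundamentalDomain
      (Submodule.span ℤ (Set.range (EuclideanSpace.basisFun (Fin 3) ℝ).toBasis)) unitCell
      (volume : Measure E3) := by
  rw [unitCell_eq_fundamentalDomain]
  exact ZSpan.isAddFundamentalDomain _ _

instance : VAddInvariantMeasure
    (Submodule.span ℤ (Set.range (EuclideanSpace.basisFun (Fin 3) ℝ).toBasis)) E3 volume :=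
  ⟨fun c s _ => by
    simp only [Submodule.vadd_def, vadd_eq_add]
    exact measure_preimage_add volume (c : E3) s⟩

lemma volume_setOf_forall_mem (s : Fin 3 → Set ℝ) (hs : ∀ i, MeasurableSet (s i)) :
    volume {x : E3 | ∀ i, x i ∈ s i} = ∏ i, volume (s i) := by
  have h := (EuclideanSpace.volume_preserving_symm_measurableEquiv_toLp (Fin 3)).measure_preimage
    (s := Set.univ.pi s) (MeasurableSet.univ_pi hs).nullMeasurableSet
  rw [← volume_pi_pi]
  rw [← h]
  congr 1
  ext x
  simp

instance : IsProbabilityMeasure torusMeasure := by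
  constructor
  rw [torusMeasure, Measure.restrict_apply_univ, unitCell, volume_setOf_forall_mem]
  · simp
  · intro i; exact measurableSet_Ico

lemma setIntegral_vadd {s : Set E3} (x : E3) {F : Type*} [NormedAddCommGroup F] [NormedSpace ℝ F]
    (f : E3 → F) : ∫ y in s, f (y - x) = ∫ y in (-x) +ᵥ s, f y := by
  have h := (measurePreserving_vadd (-x) (volume : Measure E3)).setIntegral_image_emb
    (measurableEmbedding_const_vadd (-x)) f s
  rw [← Set.image_vadd, h]
  simp [sub_eq_neg_add]

/-- A translate of the cell is again a fundamental domain of the lattice, and periodic functions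
have the same integral over any two fundamental domains. -/
lemma EulerTorus.IsPeriodic.integral_comp_sub {F : Type*} [NormedAddCommGroup F] [NormedSpace ℝ F]
    {f : E3 → F} (hf : IsPeriodic f) (x : E3) :
    ∫ y, f (y - x) ∂torusMeasure = ∫ y, f y ∂torusMeasure := by
  rw [torusMeasure, setIntegral_vadd]
  refine (isAddFundamentalDomain_unitCell.vadd_of_comm (-x)).setIntegral_eq
    isAddFundamentalDomain_unitCell fun g y => ?_
  obtain ⟨k, hk⟩ := exists_latticeVec_eq g
  rw [Submodule.vadd_def, hk, vadd_eq_add, add_comm, hf]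

lemma EulerTorus.IsPeriodic.lintegral_comp_sub {f : E3 → ℝ≥0∞} (hf : IsPeriodic f) (x : E3) :
    ∫⁻ y, f (y - x) ∂torusMeasure = ∫⁻ y, f y ∂torusMeasure := by
  have h := (measurePreserving_vadd (-x) (volume : Measure E3)).setLIntegral_comp_emb
    (measurableEmbedding_const_vadd (-x)) f unitCell
  have h' : ∫⁻ y in unitCell, f (y - x) = ∫⁻ y in (-x) +ᵥ unitCell, f y := by
    rw [← Set.image_vadd, ← h]
    simp [sub_eq_neg_add]
  rw [torusMeasure, h']
  refine (isAddFundamentalDomain_unitCell.vadd_of_comm (-x)).setLIntegral_eq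
    isAddFundamentalDomain_unitCell _ fun g y => ?_
  obtain ⟨k, hk⟩ := exists_latticeVec_eq g
  rw [Submodule.vadd_def, hk, vadd_eq_add, add_comm, hf]

/-- Rounding leaves at most `1/2` in each coordinate, hence norm at most `√3/2`. -/
lemma norm_sub_latticeVec_round_le (x : E3) : ‖x - latticeVec (fun i => round (x i))‖ ≤ 1 := by
  rw [EuclideanSpace.norm_eq, Fin.sum_univ_three, Real.sqrt_le_left one_pos.le]
  have h : ∀ i, ‖(x - latticeVec (fun i => round (x i))) i‖ ^ 2 ≤ (1 / 2) ^ 2 := fun i => by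
    have := abs_sub_round (x i)
    gcongr
    simpa [latticeVec_apply] using this
  linarith [h 0, h 1, h 2]

lemma infDist_le_one_of_isPeriodicSet {S : Set E3} (hS : IsPeriodicSet S) (hne : S.Nonempty)
    (x : E3) : Metric.infDist x S ≤ 1 := by
  obtain ⟨p, hp⟩ := hne
  have hmem := (hS p (fun i => round ((x - p) i))).2 hp
  refine (Metric.infDist_le_dist_of_mem hmem).trans ?_
  rw [dist_eq_norm, ← sub_sub]
  exact norm_sub_latticeVec_round_le (x - p)

/-- Lets a gradient bound with exponent `-κ` be weakened to exponent `θ - 1 ≤ -κ`. -/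
lemma distTo_le_one {S : Set E3} (hS : IsPeriodicSet S) (x : E3) : distTo x S ≤ 1 := by
  rw [distTo]
  split_ifs with h
  · exact le_rfl
  · exact infDist_le_one_of_isPeriodicSet hS (nonempty_iff_ne_empty.2 h) x

lemma distTo_pos {S : Set E3} (hS : IsClosed S) {x : E3} (hx : x ∉ S) : 0 < distTo x S := by
  rw [distTo]
  split_ifs with h
  · exact one_pos
  · exact (hS.notMem_iff_infDist_pos (nonempty_iff_ne_empty.2 h)).1 hx

lemma half_distTo_le {S : Set E3} {x z : E3} (h : ‖z - x‖ ≤ distTo x S / 2) :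
    distTo x S / 2 ≤ distTo z S := by
  unfold distTo at *
  split_ifs at * with hS
  · norm_num
  · have := Metric.infDist_le_infDist_add_dist (x := x) (y := z) (s := S)
    rw [dist_comm, dist_eq_norm] at this
    linarith

lemma notMem_of_distTo_pos {S : Set E3} {x : E3} (h : 0 < distTo x S) : x ∉ S := by
  intro hx
  rw [distTo, if_neg (nonempty_iff_ne_empty.1 ⟨x, hx⟩), Metric.infDist_zero_of_mem hx] at h
  exact lt_irrefl _ h

/-! ### Smooth periodic mollifiers -/

/-- A smooth even periodic mollifier at scale `r`, with the constant `C` in the bound of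
the total variation of its gradient. -/
structure IsMollifier (C r : ℝ) (ρ : E3 → ℝ) : Prop where
  smooth : ContDiff ℝ ((⊤ : ℕ∞) : WithTop ℕ∞) ρ
  periodic : IsPeriodic ρ
  even : ∀ x, ρ (-x) = ρ x
  nonneg : ∀ x, 0 ≤ ρ x
  integral_eq_one : ∫ x, ρ x ∂torusMeasure = 1
  support : ∀ x, ρ x ≠ 0 → ∃ k, ‖x - latticeVec k‖ ≤ r
  support_fderiv : ∀ x, fderiv ℝ ρ x ≠ 0 → ∃ k, ‖x - latticeVec k‖ ≤ r
  lintegral_fderiv : ∫⁻ x, ‖fderiv ℝ ρ x‖ₑ ∂torusMeasure ≤ ENNReal.ofReal (C / r)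

/-- `∑ sin² (π xᵢ)`, comparable to the squared distance to the lattice. -/
noncomputable def sinSq (x : E3) : ℝ := ∑ i, Real.sin (Real.pi * x i) ^ 2

lemma sinSq_isPeriodic : IsPeriodic sinSq := by
  intro x k
  unfold sinSq
  refine Finset.sum_congr rfl fun i _ => ?_
  rw [PiLp.add_apply, latticeVec_apply, mul_add, mul_comm Real.pi (k i : ℝ), Real.sin_add_int_mul_pi,
    mul_pow, ← zpow_natCast ((-1 : ℝ) ^ k i), ← zpow_mul, mul_comm (k i), zpow_mul]
  norm_num

lemma sinSq_neg (x : E3) : sinSq (-x) = sinSq x := by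
  simp [sinSq]

lemma abs_sin_le_of_sinSq_le {x : E3} {r : ℝ} (hr : 0 ≤ r) (h : sinSq x ≤ 2 * r ^ 2) (i : Fin 3) :
    |Real.sin (Real.pi * x i)| ≤ 2 * r := by
  have h1 : Real.sin (Real.pi * x i) ^ 2 ≤ sinSq x :=
    Finset.single_le_sum (f := fun i => Real.sin (Real.pi * x i) ^ 2)
      (fun i _ => sq_nonneg _) (Finset.mem_univ i)
  refine abs_le_of_sq_le_sq ?_ (by positivity)
  nlinarith

lemma four_mul_sq_le_sin_sq {z : ℝ} (hz : |z| ≤ 1 / 2) : 4 * z ^ 2 ≤ Real.sin (Real.pi * z) ^ 2 := by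
  have hpi := Real.pi_pos
  have h := Real.mul_abs_le_abs_sin (x := Real.pi * z) (by
    rw [abs_mul, abs_of_pos hpi]; nlinarith)
  rw [abs_mul, abs_of_pos hpi, ← mul_assoc, div_mul_cancel₀ _ hpi.ne'] at h
  rw [← sq_abs (Real.sin _), ← sq_abs z]
  nlinarith [abs_nonneg z]

/-- Jordan's inequality gives `4‖z‖² ≤ sinSq z` for the reduced point `z`. The level `2r²` is where
the cutoff of `sinSq / r²` used for the mollifier, supported in `[-2, 2]`, ends. -/
lemma norm_sub_round_le_of_sinSq_le {x : E3} {r : ℝ} (hr : 0 ≤ r) (h : sinSq x ≤ 2 * r ^ 2) :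
    ‖x - latticeVec (fun i => round (x i))‖ ≤ r := by
  set z := x - latticeVec (fun i => round (x i)) with hz
  have hz' : sinSq z = sinSq x := sinSq_isPeriodic.sub_latticeVec _ _
  have h1 : ∀ i, |z i| ≤ 1 / 2 := fun i => by
    simpa [hz, latticeVec_apply] using abs_sub_round (x i)
  rw [← hz'] at h
  have h2 := fun i => four_mul_sq_le_sin_sq (h1 i)
  rw [EuclideanSpace.norm_eq, Real.sqrt_le_left hr, Fin.sum_univ_three]
  simp only [Real.norm_eq_abs, sq_abs]
  rw [sinSq, Fin.sum_univ_three] at h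
  nlinarith [h2 0, h2 1, h2 2]

lemma hasFDerivAt_sinSq (x : E3) :
    HasFDerivAt sinSq (∑ i, (2 * Real.sin (Real.pi * x i) * (Real.cos (Real.pi * x i) * Real.pi)) •
      (EuclideanSpace.proj i : E3 →L[ℝ] ℝ)) x := by
  unfold sinSq
  refine HasFDerivAt.fun_sum fun i _ => ?_
  have h : HasDerivAt (fun s : ℝ => Real.sin (Real.pi * s) ^ 2)
      (2 * Real.sin (Real.pi * x i) * (Real.cos (Real.pi * x i) * Real.pi)) (x i) := by
    have h1 : HasDerivAt (fun s : ℝ => Real.pi * s) Real.pi (x i) := by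
      simpa using (hasDerivAt_id (x i)).const_mul Real.pi
    exact (h1.sin.pow 2).congr_deriv (by simp)
  exact h.comp_hasFDerivAt x (EuclideanSpace.proj i : E3 →L[ℝ] ℝ).hasFDerivAt

lemma contDiff_sinSq : ContDiff ℝ ((⊤ : ℕ∞) : WithTop ℕ∞) sinSq := by
  unfold sinSq
  fun_prop

lemma volume_sinSq_le {r : ℝ} (hr : 0 < r) :
    torusMeasure {x | sinSq x ≤ 2 * r ^ 2} ≤ ENNReal.ofReal ((2 * r) ^ 3) := by
  rw [torusMeasure, Measure.restrict_apply' measurableSet_unitCell]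
  have hsub : {x | sinSq x ≤ 2 * r ^ 2} ∩ unitCell ⊆
      {x : E3 | ∀ i, x i ∈ Icc 0 r ∪ Icc (1 - r) 1} := by
    rintro x ⟨hx, hx'⟩ i
    have h1 : |x i - round (x i)| ≤ r := by
      refine le_trans ?_ (norm_sub_round_le_of_sinSq_le hr.le hx)
      simpa [latticeVec_apply] using
        PiLp.norm_apply_le (x - latticeVec (fun i => round (x i))) i
    obtain ⟨h0, h2⟩ := hx' i
    rw [abs_le] at h1
    have hlo : 0 ≤ round (x i) := by
      rw [round_eq]; exact Int.floor_nonneg.2 (by linarith)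
    have hhi : round (x i) ≤ 1 := by
      rw [round_eq, ← Int.lt_add_one_iff, Int.floor_lt]; push_cast; linarith
    obtain h | h : round (x i) = 0 ∨ round (x i) = 1 := by omega
    · left; rw [h] at h1; exact ⟨h0, by simpa using h1.2⟩
    · right; rw [h] at h1; push_cast at h1; exact ⟨by linarith, h2.le⟩
  refine (measure_mono hsub).trans ?_
  rw [volume_setOf_forall_mem (fun _ => Icc 0 r ∪ Icc (1 - r) 1)
    (fun _ => measurableSet_Icc.union measurableSet_Icc), Finset.prod_const, Finset.card_univ,
    Fintype.card_fin, ENNReal.ofReal_pow (by positivity)]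
  gcongr
  refine (measure_union_le _ _).trans ?_
  rw [Real.volume_Icc, Real.volume_Icc, ← ENNReal.ofReal_add (by linarith) (by linarith)]
  apply ENNReal.ofReal_le_ofReal; linarith

lemma le_volume_sinSq_le {r : ℝ} (hr : 0 < r) (hr1 : r ≤ 1) :
    ENNReal.ofReal ((r / 6) ^ 3) ≤ torusMeasure {x | sinSq x ≤ r ^ 2} := by
  rw [torusMeasure, Measure.restrict_apply' measurableSet_unitCell]
  have hsub : {x : E3 | ∀ i, x i ∈ Icc 0 (r / 6)} ⊆ {x | sinSq x ≤ r ^ 2} ∩ unitCell := by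
    intro x hx
    refine ⟨?_, fun i => ⟨(hx i).1, by linarith [(hx i).2]⟩⟩
    have h : ∀ i, Real.sin (Real.pi * x i) ^ 2 ≤ (3.15 * r / 6) ^ 2 := fun i => by
      have hx0 := (hx i).1
      have hx1 := (hx i).2
      have h1 : Real.pi * x i ≤ 3.15 * (r / 6) :=
        mul_le_mul Real.pi_lt_d2.le hx1 hx0 (by norm_num)
      have h0 : 0 ≤ Real.pi * x i := mul_nonneg Real.pi_pos.le hx0
      have h2 := Real.sin_le h0
      have h3 : 0 ≤ Real.sin (Real.pi * x i) := Real.sin_nonneg_of_nonneg_of_le_pi h0 (by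
        linarith [Real.pi_gt_three])
      gcongr
      linarith
    change sinSq x ≤ r ^ 2
    rw [sinSq, Fin.sum_univ_three]
    -- The radius `r / 6` is small enough: `3 (3.15/6)² < 1`.
    nlinarith [h 0, h 1, h 2]
  refine le_trans ?_ (measure_mono hsub)
  rw [volume_setOf_forall_mem (fun _ => Icc 0 (r / 6)) (fun _ => measurableSet_Icc),
    Finset.prod_const, Finset.card_univ, Fintype.card_fin, Real.volume_Icc, sub_zero,
    ENNReal.ofReal_pow (by positivity)]

/-- A cutoff of `sinSq / r²`, divided by its mean `m`, is smooth, even and periodic at once, with no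
summation over the lattice. -/
lemma exists_isMollifier :
    ∃ C : ℝ, 0 < C ∧ ∀ r : ℝ, 0 < r → r ≤ 1 → ∃ ρ, IsMollifier C r ρ := by
  obtain ⟨f, hf, hfc, hf0, hf1, hfone, hfs⟩ : ∃ f : ℝ → ℝ, ContDiff ℝ ((⊤ : ℕ∞) : WithTop ℕ∞) f ∧
      HasCompactSupport f ∧ (∀ s, 0 ≤ f s) ∧ (∀ s, f s ≤ 1) ∧ (∀ s, |s| ≤ 1 → f s = 1) ∧
      tsupport f ⊆ Metric.closedBall 0 2 := by
    let f : ContDiffBump (0 : ℝ) := ⟨1, 2, one_pos, one_lt_two⟩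
    exact ⟨f, f.contDiff, f.hasCompactSupport, fun s => f.nonneg, fun s => f.le_one,
      fun s hs => f.one_of_mem_closedBall (by simpa using hs), f.tsupport_eq.le⟩
  obtain ⟨M, hM⟩ := hfc.deriv.exists_bound_of_continuous
    (hf.continuous_deriv (by simp))
  have hM0 : 0 ≤ M := (norm_nonneg _).trans (hM 0)
  -- `216` comes from `m ≥ (r/6)³`, `8` from the volume `(2r)³` of the support, and `12πM / r`
  -- bounds the gradient before normalisation. The `+ 1` makes positivity immediate.
  refine ⟨216 * 8 * (12 * Real.pi * M + 1), by positivity, fun r hr hr1 => ?_⟩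
  set η : E3 → ℝ := fun x => f (sinSq x / r ^ 2) with hη
  have hsm : ContDiff ℝ ((⊤ : ℕ∞) : WithTop ℕ∞) η := hf.comp (contDiff_sinSq.div_const _)
  have hηp : IsPeriodic η := fun x k => by simp only [hη, sinSq_isPeriodic x k]
  have hη0 : ∀ x, 0 ≤ η x := fun x => hf0 _
  have hη1 : ∀ x, η x ≤ 1 := fun x => hf1 _
  have hint : Integrable η torusMeasure :=
    Integrable.of_bound hsm.continuous.aestronglyMeasurable 1 (ae_of_all _ fun x => by
      rw [Real.norm_of_nonneg (hη0 x)]; exact hη1 x)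
  set m := ∫ x, η x ∂torusMeasure with hm
  have hmr : (r / 6) ^ 3 ≤ m := by
    rw [hm, integral_eq_lintegral_of_nonneg_ae (ae_of_all _ hη0) hint.aestronglyMeasurable,
      ← ENNReal.ofReal_le_iff_le_toReal hint.lintegral_lt_top.ne]
    refine (le_volume_sinSq_le hr hr1).trans ?_
    have hmeas : MeasurableSet {x | sinSq x ≤ r ^ 2} :=
      measurableSet_le contDiff_sinSq.continuous.measurable measurable_const
    rw [← lintegral_indicator_one hmeas]
    refine lintegral_mono fun x => ?_
    by_cases hx : sinSq x ≤ r ^ 2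
    · have : η x = 1 := hfone _ (by
        have h0 : 0 ≤ sinSq x := Finset.sum_nonneg fun i _ => sq_nonneg _
        rw [abs_of_nonneg (by positivity)]
        exact div_le_one_of_le₀ hx (by positivity))
      simp [this, hx]
    · simp [hx]
  clear_value m
  have hm0 : 0 < m := lt_of_lt_of_le (by positivity) hmr
  have hsupp : ∀ x, ¬ sinSq x ≤ 2 * r ^ 2 → sinSq x / r ^ 2 ∉ tsupport f := fun x hx h => by
    have h0 := (le_abs_self _).trans (mem_closedBall_zero_iff.1 (hfs h))
    refine hx ?_
    rwa [div_le_iff₀ (by positivity)] at h0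
  have hder : ∀ x, HasFDerivAt η (deriv f (sinSq x / r ^ 2) • ((r ^ 2)⁻¹ •
      ∑ i, (2 * Real.sin (Real.pi * x i) * (Real.cos (Real.pi * x i) * Real.pi)) •
      (EuclideanSpace.proj i : E3 →L[ℝ] ℝ))) x := fun x => by
    have h1 : HasDerivAt f (deriv f (sinSq x / r ^ 2)) (sinSq x / r ^ 2) :=
      (hf.differentiable (by simp) _).hasDerivAt
    have h2 := (hasFDerivAt_sinSq x).mul_const ((r ^ 2)⁻¹)
    exact h1.comp_hasFDerivAt x h2
  clear_value η
  have hfd : ∀ x, ¬ sinSq x ≤ 2 * r ^ 2 → fderiv ℝ η x = 0 := fun x hx => by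
    rw [(hder x).fderiv, image_eq_zero_of_notMem_tsupport
      (fun h => hsupp x hx (tsupport_deriv_subset h)), zero_smul]
  have hfdb : ∀ x, ‖fderiv ℝ η x‖ ≤ 12 * Real.pi * M / r := fun x => by
    by_cases hx : sinSq x ≤ 2 * r ^ 2
    · rw [(hder x).fderiv, norm_smul, norm_smul, norm_inv, norm_pow, Real.norm_of_nonneg hr.le]
      have hsum : ‖∑ i, (2 * Real.sin (Real.pi * x i) * (Real.cos (Real.pi * x i) * Real.pi)) •
          (EuclideanSpace.proj i : E3 →L[ℝ] ℝ)‖ ≤ ∑ i : Fin 3, 4 * r * Real.pi := by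
        refine norm_sum_le_of_le _ fun i _ => ?_
        have hp : ‖(EuclideanSpace.proj i : E3 →L[ℝ] ℝ)‖ ≤ 1 :=
          ContinuousLinearMap.opNorm_le_bound _ zero_le_one fun y => by
            simpa using PiLp.norm_apply_le y i
        have hs := abs_sin_le_of_sinSq_le hr.le hx i
        have hc := Real.abs_cos_le_one (Real.pi * x i)
        rw [norm_smul, norm_mul, norm_mul, norm_mul, Real.norm_of_nonneg Real.pi_pos.le,
          Real.norm_eq_abs, Real.norm_eq_abs, Real.norm_eq_abs, abs_two]
        calc _ ≤ 2 * (2 * r) * (1 * Real.pi) * 1 := by gcongr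
          _ = _ := by ring
      calc _ ≤ M * ((r ^ 2)⁻¹ * ∑ i : Fin 3, 4 * r * Real.pi) := by gcongr; exact hM _
        _ = _ := by simp; field_simp; ring
    · rw [hfd x hx, norm_zero]; positivity
  have hfds : fderiv ℝ (fun x => m⁻¹ * η x) = fun x => m⁻¹ • fderiv ℝ η x := by
    funext x
    exact fderiv_const_mul (hder x).differentiableAt _
  refine ⟨fun x => m⁻¹ * η x, contDiff_const.mul hsm, fun x k => by rw [hηp x k], fun x => ?_,
    fun x => by have := hη0 x; positivity, ?_, fun x hx => ?_, fun x hx => ?_, ?_⟩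
  · simp only [hη, sinSq_neg]
  · rw [integral_const_mul, ← hm, inv_mul_cancel₀ hm0.ne']
  · refine ⟨_, norm_sub_round_le_of_sinSq_le hr.le ?_⟩
    by_contra h
    exact hx (by simp [hη, image_eq_zero_of_notMem_tsupport (hsupp x h)])
  · refine ⟨_, norm_sub_round_le_of_sinSq_le hr.le ?_⟩
    by_contra h
    exact hx (by simp [hfds, hfd x h])
  · have hmeas : MeasurableSet {x | sinSq x ≤ 2 * r ^ 2} :=
      measurableSet_le contDiff_sinSq.continuous.measurable measurable_const
    have hle : ∀ x, ‖fderiv ℝ (fun x => m⁻¹ * η x) x‖ₑ ≤ {x | sinSq x ≤ 2 * r ^ 2}.indicator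
        (fun _ => ENNReal.ofReal (m⁻¹ * (12 * Real.pi * M / r))) x := fun x => by
      by_cases hx : sinSq x ≤ 2 * r ^ 2
      · rw [indicator_of_mem (by exact hx), hfds, ← ofReal_norm, norm_smul,
          Real.norm_of_nonneg (by positivity)]
        gcongr
        exact hfdb x
      · rw [hfds, ← ofReal_norm, norm_smul, hfd x hx, norm_zero, mul_zero, ENNReal.ofReal_zero]
        exact zero_le
    refine (lintegral_mono hle).trans ?_
    rw [lintegral_indicator_const hmeas]
    refine (mul_le_mul' le_rfl (volume_sinSq_le hr)).trans ?_
    rw [← ENNReal.ofReal_mul (by positivity)]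
    refine ENNReal.ofReal_le_ofReal ?_
    have hminv : m⁻¹ ≤ ((r / 6) ^ 3)⁻¹ := inv_anti₀ (by positivity) hmr
    calc _ ≤ ((r / 6) ^ 3)⁻¹ * (12 * Real.pi * M / r) * (2 * r) ^ 3 := by gcongr
      _ = 216 * 8 * (12 * Real.pi * M) / r := by field_simp; ring
      _ ≤ _ := by gcongr; linarith

/-! ### Periodic mollification -/

lemma EulerTorus.IsPeriodic.exists_bound {F : Type*} [NormedAddCommGroup F] {f : E3 → F}
    (hf : IsPeriodic f) (hc : Continuous f) : ∃ M, 0 ≤ M ∧ ∀ x, ‖f x‖ ≤ M := by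
  obtain ⟨M, hM⟩ := (isCompact_closedBall (0 : E3) 1).exists_bound_of_continuousOn hc.continuousOn
  refine ⟨M, (norm_nonneg _).trans (hM 0 (by simp)), fun x => ?_⟩
  rw [← hf.sub_latticeVec x (fun i => round (x i))]
  exact hM _ (mem_closedBall_zero_iff.2 (norm_sub_latticeVec_round_le x))

lemma EulerTorus.IsPeriodic.fderiv {F : Type*} [NormedAddCommGroup F] [NormedSpace ℝ F]
    {f : E3 → F} (hf : IsPeriodic f) : IsPeriodic (fderiv ℝ f) := by
  intro x k
  rw [← fderiv_comp_add_right]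
  congr 1
  funext y
  exact hf y k

/-- The mollification of a field on the torus by the periodic kernel `ρ`. -/
noncomputable def mollify (ρ : E3 → ℝ) (u : E3 → E3) (x : E3) : E3 :=
  ∫ y, ρ (y - x) • u y ∂torusMeasure

lemma IsMollifier.continuous {C r : ℝ} {ρ : E3 → ℝ} (h : IsMollifier C r ρ) : Continuous ρ :=
  h.smooth.continuous

lemma IsMollifier.differentiable {C r : ℝ} {ρ : E3 → ℝ} (h : IsMollifier C r ρ) :
    Differentiable ℝ ρ :=
  h.smooth.differentiable (by simp)

lemma IsMollifier.continuous_fderiv {C r : ℝ} {ρ : E3 → ℝ} (h : IsMollifier C r ρ) :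
    Continuous (fderiv ℝ ρ) :=
  h.smooth.continuous_fderiv (by simp)

lemma IsMollifier.sub_comm {C r : ℝ} {ρ : E3 → ℝ} (h : IsMollifier C r ρ) (x y : E3) :
    ρ (x - y) = ρ (y - x) := by
  rw [← neg_sub, h.even]

lemma IsMollifier.fderiv_sub_comm {C r : ℝ} {ρ : E3 → ℝ} (h : IsMollifier C r ρ) (x y : E3) :
    fderiv ℝ ρ (x - y) = -fderiv ℝ ρ (y - x) := by
  have h1 : (fun z => ρ (-z)) = ρ := funext h.even
  have h2 := ((h.differentiable (-(y - x))).hasFDerivAt.comp (y - x) (hasFDerivAt_id _).neg).fderiv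
  change fderiv ℝ (fun z => ρ (-z)) (y - x) = _ at h2
  rw [h1, neg_sub] at h2
  rw [h2]
  ext; simp

lemma norm_le_two_of_mem_unitCell {y : E3} (hy : y ∈ unitCell) : ‖y‖ ≤ 2 := by
  rw [EuclideanSpace.norm_eq, Real.sqrt_le_left zero_le_two, Fin.sum_univ_three]
  have : ∀ i, ‖y i‖ ^ 2 ≤ 1 := fun i => by
    have h := hy i
    rw [Real.norm_of_nonneg h.1]
    exact pow_le_one₀ h.1 h.2.le
  linarith [this 0, this 1, this 2]

open scoped Convolution in
-- A periodic kernel has no compact support, so it is cut off by a bump around `x₀`. For `x` within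
-- `1` of `x₀` and `y` in the cell, `x - y` stays within `3` of `x₀`, where the bump is `1`; locally
-- the mollification is thus a convolution with a compactly supported smooth kernel.
lemma IsMollifier.contDiff_mollify {C r : ℝ} {ρ : E3 → ℝ} (h : IsMollifier C r ρ) {u : E3 → E3}
    (hu : Integrable u torusMeasure) :
    ContDiff ℝ ((⊤ : ℕ∞) : WithTop ℕ∞) (mollify ρ u) := by
  rw [contDiff_iff_contDiffAt]
  intro x₀
  let χ : ContDiffBump x₀ := ⟨4, 5, by norm_num, by norm_num⟩
  have hc : HasCompactSupport (fun z => χ z * ρ z) := χ.hasCompactSupport.mul_right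
  have hs : ContDiff ℝ ((⊤ : ℕ∞) : WithTop ℕ∞) (fun z => χ z * ρ z) := χ.contDiff.mul h.smooth
  have hconv := hc.contDiff_convolution_right (μ := torusMeasure)
    (ContinuousLinearMap.lsmul ℝ ℝ : ℝ →L[ℝ] E3 →L[ℝ] E3).flip hu.locallyIntegrable hs
  refine hconv.contDiffAt.congr_of_eventuallyEq ?_
  filter_upwards [Metric.ball_mem_nhds x₀ one_pos] with x hx
  rw [mollify, convolution]
  refine setIntegral_congr_fun measurableSet_unitCell fun y hy => ?_
  have h1 : χ (x - y) = 1 := χ.one_of_mem_closedBall (by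
    rw [mem_closedBall_iff_norm, sub_right_comm]
    rw [mem_ball_iff_norm] at hx
    calc _ ≤ ‖x - x₀‖ + ‖y‖ := norm_sub_le _ _
      _ ≤ 1 + 2 := add_le_add hx.le (norm_le_two_of_mem_unitCell hy)
      _ ≤ (4 : ℝ) := by norm_num)
  simp [h1, h.sub_comm x y]

lemma integrable_kernel_smul {F : Type*} [NormedAddCommGroup F] [NormedSpace ℝ F]
    {k : E3 → ℝ} (hk : Continuous k) (hp : IsPeriodic k) {u : E3 → F}
    (hu : Integrable u torusMeasure) (x : E3) :
    Integrable (fun y => k (y - x) • u y) torusMeasure := by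
  obtain ⟨M, -, hM⟩ := hp.exists_bound hk
  exact hu.bdd_smul M (hk.comp (by fun_prop)).aestronglyMeasurable (ae_of_all _ fun y => hM _)

lemma aestronglyMeasurable_smulRight {L : E3 → E3 →L[ℝ] ℝ} (hL : Continuous L) {u : E3 → E3}
    (hu : AEStronglyMeasurable u torusMeasure) (x : E3) :
    AEStronglyMeasurable (fun y => (L (y - x)).smulRight (u y)) torusMeasure := by
  have h1 : AEStronglyMeasurable (fun y => L (y - x)) torusMeasure :=
    (hL.comp (by fun_prop)).aestronglyMeasurable
  exact (ContinuousLinearMap.smulRightL ℝ E3 E3).aestronglyMeasurable_comp₂ h1 hu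

lemma integrable_smulRight {L : E3 → E3 →L[ℝ] ℝ} (hL : Continuous L) (hp : IsPeriodic L)
    {u : E3 → E3} (hu : Integrable u torusMeasure) (x : E3) :
    Integrable (fun y => (L (y - x)).smulRight (u y)) torusMeasure := by
  obtain ⟨M, -, hM⟩ := hp.exists_bound hL
  refine (hu.norm.const_mul M).mono' (aestronglyMeasurable_smulRight hL hu.1 x)
    (ae_of_all _ fun y => ?_)
  rw [ContinuousLinearMap.norm_smulRight_apply]
  gcongr
  exact hM _

lemma IsMollifier.hasFDerivAt_mollify {C r : ℝ} {ρ : E3 → ℝ} (h : IsMollifier C r ρ) {u : E3 → E3}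
    (hu : Integrable u torusMeasure) (x : E3) :
    HasFDerivAt (mollify ρ u)
      (-∫ y, (fderiv ℝ ρ (y - x)).smulRight (u y) ∂torusMeasure) x := by
  obtain ⟨M, -, hM⟩ := h.periodic.fderiv.exists_bound h.continuous_fderiv
  rw [← integral_neg]
  refine hasFDerivAt_integral_of_dominated_of_fderiv_le (s := univ)
    (bound := fun y => M * ‖u y‖) (F' := fun z y => -(fderiv ℝ ρ (y - z)).smulRight (u y)) univ_mem
    (Eventually.of_forall fun z => (integrable_kernel_smul h.continuous h.periodic hu z).1)
    (integrable_kernel_smul h.continuous h.periodic hu x)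
    (aestronglyMeasurable_smulRight h.continuous_fderiv hu.1 x).neg
    (ae_of_all _ fun y z _ => ?_) (hu.norm.const_mul M) (ae_of_all _ fun y z _ => ?_)
  · rw [norm_neg, ContinuousLinearMap.norm_smulRight_apply]
    gcongr
    exact hM _
  · have h1 : HasFDerivAt (fun z => ρ (y - z)) (-fderiv ℝ ρ (y - z)) z := by
      have h2 := (h.differentiable (y - z)).hasFDerivAt.comp z ((hasFDerivAt_id z).const_sub y)
      exact h2.congr_fderiv (by ext; simp)
    exact (h1.smul_const (u y)).congr_fderiv (by ext; simp)

lemma IsMollifier.fderiv_mollify {C r : ℝ} {ρ : E3 → ℝ} (h : IsMollifier C r ρ) {u : E3 → E3}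
    (hu : Integrable u torusMeasure) (x : E3) :
    fderiv ℝ (mollify ρ u) x = -∫ y, (fderiv ℝ ρ (y - x)).smulRight (u y) ∂torusMeasure :=
  (h.hasFDerivAt_mollify hu x).fderiv

lemma IsMollifier.fderiv_mollify_apply {C r : ℝ} {ρ : E3 → ℝ} (h : IsMollifier C r ρ) {u : E3 → E3}
    (hu : Integrable u torusMeasure) (x e : E3) :
    fderiv ℝ (mollify ρ u) x e = -∫ y, fderiv ℝ ρ (y - x) e • u y ∂torusMeasure := by
  rw [h.fderiv_mollify hu, neg_apply, ContinuousLinearMap.integral_apply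
    (integrable_smulRight h.continuous_fderiv h.periodic.fderiv hu x)]
  rfl

lemma IsMollifier.isPeriodic_mollify {C r : ℝ} {ρ : E3 → ℝ} (h : IsMollifier C r ρ) (u : E3 → E3) :
    IsPeriodic (mollify ρ u) := by
  intro x k
  simp only [mollify, ← sub_sub, h.periodic.sub_latticeVec]

/-- The trace of the rank-one map `e ↦ L e • u` is `L u`. -/
lemma IsMollifier.divergence_mollify {C r : ℝ} {ρ : E3 → ℝ} (h : IsMollifier C r ρ) {u : E3 → E3}
    (hu : Integrable u torusMeasure) (x : E3) :
    divergence (mollify ρ u) x = -∫ y, fderiv ℝ ρ (y - x) (u y) ∂torusMeasure := by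
  let tr : (E3 →L[ℝ] E3) →L[ℝ] ℝ := ∑ i, (EuclideanSpace.proj i : E3 →L[ℝ] ℝ).comp
    (ContinuousLinearMap.apply ℝ E3 (EuclideanSpace.single i 1))
  have htr : ∀ A : E3 →L[ℝ] E3, tr A = ∑ i, (A (EuclideanSpace.single i 1)) i := fun A => by
    simp [tr]
  rw [divergence, ← htr, h.fderiv_mollify hu, map_neg, ← tr.integral_comp_comm
    (integrable_smulRight h.continuous_fderiv h.periodic.fderiv hu x)]
  congr 1
  refine integral_congr_ae (ae_of_all _ fun y => ?_)
  change tr _ = _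
  rw [htr]
  have hsum : u y = ∑ i, (u y) i • EuclideanSpace.single i (1 : ℝ) := by
    have := (EuclideanSpace.basisFun (Fin 3) ℝ).sum_repr (u y)
    simpa using this.symm
  change _ = fderiv ℝ ρ (y - x) (u y)
  conv_rhs => rw [hsum, map_sum]
  refine Finset.sum_congr rfl fun i _ => ?_
  simp [mul_comm]

/-- Mollifying a constant field returns it, so its derivative vanishes; this replaces an integration
by parts on the torus. -/
lemma IsMollifier.integral_fderiv_apply {C r : ℝ} {ρ : E3 → ℝ} (h : IsMollifier C r ρ) (x e : E3) :
    ∫ y, fderiv ℝ ρ (y - x) e ∂torusMeasure = 0 := by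
  have h1 : mollify ρ (fun _ => e) = fun _ => e := by
    funext z
    rw [mollify, integral_smul_const, h.periodic.integral_comp_sub, h.integral_eq_one, one_smul]
  by_cases he : e = 0
  · simp [he]
  have h2 := h.fderiv_mollify_apply (integrable_const e) x e
  rw [h1, integral_smul_const] at h2
  simpa [he] using h2

/-! ### Square integrable fields on the torus -/

/-- The `L²` norm on the torus as a real number. -/
noncomputable def torusL2 (f : E3 → E3) : ℝ := (eLpNorm f 2 torusMeasure).toReal

lemma integrable_norm_mul_norm {f g : E3 → E3} (hf : MemLp f 2 torusMeasure)
    (hg : MemLp g 2 torusMeasure) : Integrable (fun x => ‖f x‖ * ‖g x‖) torusMeasure :=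
  hf.norm.integrable_mul hg.norm

/-- Cauchy–Schwarz, read off from the inner product of `L²`. -/
lemma integral_norm_mul_norm_le {f g : E3 → E3} (hf : MemLp f 2 torusMeasure)
    (hg : MemLp g 2 torusMeasure) :
    ∫ x, ‖f x‖ * ‖g x‖ ∂torusMeasure ≤ torusL2 f * torusL2 g := by
  have h := real_inner_le_norm (hf.norm.toLp _) (hg.norm.toLp _)
  rw [Lp.norm_toLp, Lp.norm_toLp, eLpNorm_norm, eLpNorm_norm, L2.inner_def] at h
  refine le_trans (le_of_eq ?_) h
  refine integral_congr_ae ?_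
  filter_upwards [hf.norm.coeFn_toLp, hg.norm.coeFn_toLp] with x h1 h2
  rw [h1, h2]
  simp [mul_comm]

lemma integral_norm_le {f : E3 → E3} (hf : MemLp f 2 torusMeasure) :
    ∫ x, ‖f x‖ ∂torusMeasure ≤ torusL2 f := by
  rw [integral_norm_eq_lintegral_enorm hf.1, ← eLpNorm_one_eq_lintegral_enorm]
  exact ENNReal.toReal_mono hf.2.ne
    (eLpNorm_le_eLpNorm_of_exponent_le one_le_two hf.1)

lemma torusL2_sub_comm (f g : E3 → E3) : torusL2 (f - g) = torusL2 (g - f) := by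
  rw [torusL2, torusL2, eLpNorm_sub_comm]

lemma torusL2_le_add {f g : E3 → E3} (hf : MemLp f 2 torusMeasure) (hg : MemLp g 2 torusMeasure) :
    torusL2 f ≤ torusL2 g + torusL2 (f - g) := by
  rw [torusL2, torusL2, torusL2, ← ENNReal.toReal_add hg.2.ne (hf.sub hg).2.ne]
  refine ENNReal.toReal_mono (ENNReal.add_ne_top.2 ⟨hg.2.ne, (hf.sub hg).2.ne⟩) ?_
  have := eLpNorm_add_le (μ := torusMeasure) (p := 2) hg.1 (hf.sub hg).1 one_le_two
  simpa using this

lemma integral_inner_le {f g : E3 → E3} (hf : MemLp f 2 torusMeasure)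
    (hg : MemLp g 2 torusMeasure) :
    |∫ x, inner ℝ (f x) (g x) ∂torusMeasure| ≤ torusL2 f * torusL2 g := by
  rw [← Real.norm_eq_abs]
  exact (norm_integral_le_of_norm_le (integrable_norm_mul_norm hf hg)
    (ae_of_all _ fun _ => norm_inner_le_norm _ _)).trans (integral_norm_mul_norm_le hf hg)

lemma integrable_inner_of_memLp {f g : E3 → E3} (hf : MemLp f 2 torusMeasure)
    (hg : MemLp g 2 torusMeasure) : Integrable (fun x => inner ℝ (f x) (g x)) torusMeasure :=
  (integrable_norm_mul_norm hf hg).mono' (hf.1.inner hg.1)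
    (ae_of_all _ fun _ => norm_inner_le_norm _ _)

lemma memLp_clm_apply {A : E3 → E3 →L[ℝ] E3} (hA : Continuous A) (hp : IsPeriodic A)
    {f : E3 → E3} (hf : MemLp f 2 torusMeasure) : MemLp (fun x => A x (f x)) 2 torusMeasure := by
  obtain ⟨M, -, hM⟩ := hp.exists_bound hA
  refine hf.of_le_mul (c := M) ?_ (ae_of_all _ fun x => ?_)
  · exact (ContinuousLinearMap.id ℝ (E3 →L[ℝ] E3)).aestronglyMeasurable_comp₂
      hA.aestronglyMeasurable hf.1
  · exact (A x).le_of_opNorm_le (hM x) _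

lemma memLp_of_continuous {w : E3 → E3} (hw : Continuous w) (hp : IsPeriodic w) :
    MemLp w 2 torusMeasure := by
  obtain ⟨M, -, hM⟩ := hp.exists_bound hw
  exact MemLp.of_bound hw.aestronglyMeasurable M (ae_of_all _ hM)

lemma abs_integral_inner_clm_le {A : E3 → E3 →L[ℝ] E3} {M : ℝ} (hM : ∀ x, ‖A x‖ ≤ M)
    {f g : E3 → E3} (hf : MemLp f 2 torusMeasure) (hg : MemLp g 2 torusMeasure) :
    |∫ x, inner ℝ (f x) (A x (g x)) ∂torusMeasure| ≤ M * (torusL2 f * torusL2 g) := by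
  have hM0 : 0 ≤ M := (norm_nonneg _).trans (hM 0)
  rw [← Real.norm_eq_abs]
  refine (norm_integral_le_of_norm_le ((integrable_norm_mul_norm hf hg).const_mul M)
    (ae_of_all _ fun x => ?_)).trans ?_
  · calc ‖inner ℝ (f x) (A x (g x))‖ ≤ ‖f x‖ * ‖A x (g x)‖ := norm_inner_le_norm _ _
      _ ≤ ‖f x‖ * (M * ‖g x‖) := by gcongr; exact (A x).le_of_opNorm_le (hM x) _
      _ = _ := by ring
  · rw [integral_const_mul]
    gcongr
    exact integral_norm_mul_norm_le hf hg

/-- Telescoping: change the matrix field first, then each of the two vector arguments in turn. -/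
lemma abs_quadratic_sub_le {A A₀ : E3 → E3 →L[ℝ] E3} (hA : Continuous A) (hA₀ : Continuous A₀)
    (hp : IsPeriodic A) (hp₀ : IsPeriodic A₀) {D M : ℝ} (hD : ∀ x, ‖A x - A₀ x‖ ≤ D)
    (hM : ∀ x, ‖A₀ x‖ ≤ M) {f f₀ : E3 → E3} (hf : MemLp f 2 torusMeasure)
    (hf₀ : MemLp f₀ 2 torusMeasure) :
    |(∫ x, inner ℝ (f x) (A x (f x)) ∂torusMeasure) -
      ∫ x, inner ℝ (f₀ x) (A₀ x (f₀ x)) ∂torusMeasure| ≤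
      D * (torusL2 f * torusL2 f) +
        M * (torusL2 (f - f₀) * torusL2 f + torusL2 f₀ * torusL2 (f - f₀)) := by
  have hd := hf.sub hf₀
  have h1 := abs_integral_inner_clm_le hD hf hf
  have h2 := abs_integral_inner_clm_le hM hd hf
  have h3 := abs_integral_inner_clm_le hM hf₀ hd
  have hcd : Continuous (fun x => A x - A₀ x) := hA.sub hA₀
  have hpd : IsPeriodic (fun x => A x - A₀ x) := fun x k => by simp only [hp x k, hp₀ x k]
  have i1 := integrable_inner_of_memLp hf (memLp_clm_apply hcd hpd hf)
  have i2 := integrable_inner_of_memLp hd (memLp_clm_apply hA₀ hp₀ hf)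
  have i3 := integrable_inner_of_memLp hf₀ (memLp_clm_apply hA₀ hp₀ hd)
  have e : (∫ x, inner ℝ (f x) (A x (f x)) ∂torusMeasure) -
      ∫ x, inner ℝ (f₀ x) (A₀ x (f₀ x)) ∂torusMeasure =
      (∫ x, inner ℝ (f x) ((A x - A₀ x) (f x)) ∂torusMeasure) +
      (∫ x, inner ℝ ((f - f₀) x) (A₀ x (f x)) ∂torusMeasure) +
      ∫ x, inner ℝ (f₀ x) (A₀ x ((f - f₀) x)) ∂torusMeasure := by
    rw [← integral_sub (integrable_inner_of_memLp hf (memLp_clm_apply hA hp hf))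
      (integrable_inner_of_memLp hf₀ (memLp_clm_apply hA₀ hp₀ hf₀)), ← integral_add i1 i2,
      ← integral_add (by exact i1.add i2) i3]
    refine integral_congr_ae (ae_of_all _ fun x => ?_)
    simp only [Pi.sub_apply, sub_apply, map_sub, inner_sub_left, inner_sub_right]
    ring
  rw [e]
  refine (abs_add_le _ _).trans ?_
  have := abs_add_le (∫ x, inner ℝ (f x) ((A x - A₀ x) (f x)) ∂torusMeasure)
    (∫ x, inner ℝ ((f - f₀) x) (A₀ x (f x)) ∂torusMeasure)
  linarith

/-! ### Curves of square integrable fields -/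

/-- A continuous curve of square integrable fields on the torus. -/
structure IsL2Curve (u : ℝ → E3 → E3) : Prop where
  memLp : ∀ t, MemLp (u t) 2 torusMeasure
  tendsto : ∀ t, Tendsto (fun s => torusL2 (u s - u t)) (𝓝 t) (𝓝 0)

lemma IsL2Curve.integrable {u : ℝ → E3 → E3} (hu : IsL2Curve u) (t : ℝ) :
    Integrable (u t) torusMeasure :=
  (hu.memLp t).integrable one_le_two

lemma IsL2Curve.continuous_torusL2 {u : ℝ → E3 → E3} (hu : IsL2Curve u) :
    Continuous fun t => torusL2 (u t) := by
  rw [continuous_iff_continuousAt]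
  intro t
  rw [ContinuousAt, tendsto_iff_dist_tendsto_zero]
  refine squeeze_zero (fun _ => dist_nonneg) (fun s => ?_) (hu.tendsto t)
  rw [Real.dist_eq, abs_le]
  have h1 := torusL2_le_add (hu.memLp s) (hu.memLp t)
  have h2 := torusL2_le_add (hu.memLp t) (hu.memLp s)
  rw [torusL2_sub_comm (u t)] at h2
  constructor <;> linarith

lemma IsL2Curve.continuous_inner {u : ℝ → E3 → E3} (hu : IsL2Curve u) {w : E3 → E3}
    (hw : MemLp w 2 torusMeasure) :
    Continuous fun t => ∫ x, inner ℝ (u t x) (w x) ∂torusMeasure := by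
  rw [continuous_iff_continuousAt]
  intro t
  rw [ContinuousAt, tendsto_iff_dist_tendsto_zero]
  have h0 := (hu.tendsto t).mul_const (torusL2 w)
  rw [zero_mul] at h0
  refine squeeze_zero (fun _ => dist_nonneg) (fun s => ?_) h0
  rw [Real.dist_eq, ← integral_sub (integrable_inner_of_memLp (hu.memLp s) hw)
    (integrable_inner_of_memLp (hu.memLp t) hw)]
  simpa only [Pi.sub_apply, inner_sub_left] using
    integral_inner_le ((hu.memLp s).sub (hu.memLp t)) hw

/-- The parameter `ι` serves two uses: a point, for a fixed test field, and a second time variable,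
for the gradient of the mollified solution. -/
lemma IsL2Curve.continuous_quadratic {u : ℝ → E3 → E3} (hu : IsL2Curve u)
    {ι : Type*} [TopologicalSpace ι] {A : ι → E3 → E3 →L[ℝ] E3} (hA : ∀ i, Continuous (A i))
    (hp : ∀ i, IsPeriodic (A i)) {D : ι → ι → ℝ} (hD : ∀ i j x, ‖A i x - A j x‖ ≤ D i j)
    (hD0 : ∀ j, Tendsto (fun i => D i j) (𝓝 j) (𝓝 0)) :
    Continuous fun z : ι × ℝ =>
      ∫ x, inner ℝ (u z.2 x) (A z.1 x (u z.2 x)) ∂torusMeasure := by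
  rw [continuous_iff_continuousAt]
  rintro ⟨j, t⟩
  obtain ⟨M, -, hM⟩ := (hp j).exists_bound (hA j)
  rw [ContinuousAt, tendsto_iff_dist_tendsto_zero]
  refine squeeze_zero (fun _ => dist_nonneg) (fun z => abs_quadratic_sub_le (hA z.1) (hA j)
    (hp z.1) (hp j) (hD z.1 j) hM (hu.memLp z.2) (hu.memLp t)) ?_
  have h1 : Tendsto (fun z : ι × ℝ => D z.1 j) (𝓝 (j, t)) (𝓝 0) :=
    (hD0 j).comp (continuous_fst.tendsto (j, t))
  have h2 : Tendsto (fun z : ι × ℝ => torusL2 (u z.2)) (𝓝 (j, t)) (𝓝 (torusL2 (u t))) :=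
    (hu.continuous_torusL2.tendsto t).comp (continuous_snd.tendsto (j, t))
  have h3 : Tendsto (fun z : ι × ℝ => torusL2 (u z.2 - u t)) (𝓝 (j, t)) (𝓝 0) :=
    (hu.tendsto t).comp (continuous_snd.tendsto (j, t))
  have := (h1.mul (h2.mul h2)).add (((h3.mul h2).add (h3.const_mul (torusL2 (u t)))).const_mul M)
  simpa using this

/-! ### Weak time derivatives -/

open scoped Convolution in
-- The du Bois-Reymond lemma. The derivative at `x` of a mollification of `h` is, up to sign, the
-- pairing of `h` with the derivative of the test function `τ ↦ φ(x - τ)`, hence zero. So the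
-- mollification is constant away from the end points, and it is within `ε / 2` of `h` at both `s`
-- and `t`.
lemma eqOn_const_of_integral_deriv_mul_eq_zero {T : ℝ} {h : ℝ → ℝ} (hc : Continuous h)
    (hw : ∀ χ : ℝ → ℝ, ContDiff ℝ ((⊤ : ℕ∞) : WithTop ℕ∞) χ →
      (∃ a b, 0 < a ∧ b < T ∧ ∀ t, t ∉ Icc a b → χ t = 0) →
      ∫ t in Icc 0 T, deriv χ t * h t = 0)
    {s t : ℝ} (hs : s ∈ Ioo 0 T) (ht : t ∈ Ioo 0 T) : h s = h t := by
  refine eq_of_forall_dist_le fun ε hε => ?_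
  obtain ⟨δ₁, hδ₁, h₁⟩ := Metric.continuous_iff.1 hc s (ε / 2) (half_pos hε)
  obtain ⟨δ₂, hδ₂, h₂⟩ := Metric.continuous_iff.1 hc t (ε / 2) (half_pos hε)
  obtain ⟨r, hr, hr'⟩ : ∃ r > 0, r < δ₁ ∧ r < δ₂ ∧ r < s ∧ r < t ∧ r < T - s ∧ r < T - t := by
    have hm : 0 < min δ₁ (min δ₂ (min s (min t (min (T - s) (T - t))))) := by
      simp only [lt_min_iff]
      exact ⟨hδ₁, hδ₂, hs.1, ht.1, sub_pos.2 hs.2, sub_pos.2 ht.2⟩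
    obtain ⟨r, hr0, hr⟩ := exists_between hm
    simp only [lt_min_iff] at hr
    exact ⟨r, hr0, hr⟩
  obtain ⟨hr1, hr2, hr3, hr4, hr5, hr6⟩ := hr'
  let φ : ContDiffBump (0 : ℝ) := ⟨r / 2, r, half_pos hr, half_lt_self hr⟩
  set L : ℝ →L[ℝ] ℝ →L[ℝ] ℝ := ContinuousLinearMap.lsmul ℝ ℝ with hL
  have hφs : ContDiff ℝ ((⊤ : ℕ∞) : WithTop ℕ∞) (φ.normed volume) := φ.contDiff_normed
  have hφ0 : ∀ τ, r < |τ| → φ.normed volume τ = 0 := fun τ hτ => by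
    refine image_eq_zero_of_notMem_tsupport fun hmem => ?_
    rw [φ.tsupport_normed_eq, mem_closedBall_zero_iff] at hmem
    exact absurd hmem (not_le.2 hτ)
  have hd1 : dist ((φ.normed volume ⋆[L] h) s) (h s) ≤ ε / 2 :=
    φ.dist_normed_convolution_le hc.aestronglyMeasurable
      fun x hx => (h₁ x (lt_trans hx hr1)).le
  have hd2 : dist ((φ.normed volume ⋆[L] h) t) (h t) ≤ ε / 2 :=
    φ.dist_normed_convolution_le hc.aestronglyMeasurable
      fun x hx => (h₂ x (lt_trans hx hr2)).le
  have hder := fun x => φ.hasCompactSupport_normed.hasDerivAt_convolution_left (μ := volume) L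
    (hφs.of_le (by simp)) (hc.locallyIntegrable (μ := volume)) x
  have hzero : ∀ x ∈ Ioo r (T - r), (deriv (φ.normed volume) ⋆[L] h) x = 0 := fun x hx => by
    have hχ : ContDiff ℝ ((⊤ : ℕ∞) : WithTop ℕ∞) (fun τ => φ.normed volume (x - τ)) :=
      hφs.comp (contDiff_const.sub contDiff_id)
    have hsupp : ∀ τ, τ ∉ Icc (x - r) (x + r) → φ.normed volume (x - τ) = 0 := fun τ hτ => by
      refine hφ0 _ ?_
      by_contra hle
      rw [not_lt, abs_le] at hle
      exact hτ ⟨by linarith [hle.2], by linarith [hle.1]⟩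
    have hdχ : ∀ τ, deriv (fun τ => φ.normed volume (x - τ)) τ
        = -deriv (φ.normed volume) (x - τ) := fun τ => by
      rw [deriv_comp_const_sub]
    have h0 := hw _ hχ ⟨x - r, x + r, by linarith [hx.1], by linarith [hx.2], hsupp⟩
    rw [setIntegral_eq_integral_of_forall_compl_eq_zero] at h0
    · rw [convolution_eq_swap]
      simp only [hdχ, neg_mul, integral_neg, neg_eq_zero] at h0
      simpa [hL] using h0
    · intro τ hτ
      have hev : (fun τ => φ.normed volume (x - τ)) =ᶠ[𝓝 τ] fun _ => 0 := by
        have hopen : IsOpen (Icc (x - r) (x + r))ᶜ := isClosed_Icc.isOpen_compl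
        refine Filter.eventually_of_mem (hopen.mem_nhds fun hmem => hτ ?_) hsupp
        exact ⟨by linarith [hx.1, hmem.1], by linarith [hx.2, hmem.2]⟩
      rw [hev.deriv_eq]
      simp
  have hconst := isOpen_Ioo.is_const_of_deriv_eq_zero (s := Ioo r (T - r)) isPreconnected_Ioo
    (fun x _ => (hder x).differentiableAt.differentiableWithinAt)
    (fun x hx => by rw [(hder x).deriv, hzero x hx]; rfl)
    (show s ∈ Ioo r (T - r) from ⟨hr3, by linarith⟩)
    (show t ∈ Ioo r (T - r) from ⟨hr4, by linarith⟩)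
  rw [hconst] at hd1
  calc dist (h s) (h t) ≤ _ := dist_triangle_left _ _ _
    _ ≤ ε := by linarith

/-- Subtracting a primitive of `H` reduces to a vanishing weak derivative. -/
lemma hasDerivAt_of_weak_deriv {T : ℝ} {g H : ℝ → ℝ} (hg : Continuous g) (hH : Continuous H)
    (hw : ∀ χ : ℝ → ℝ, ContDiff ℝ ((⊤ : ℕ∞) : WithTop ℕ∞) χ →
      (∃ a b, 0 < a ∧ b < T ∧ ∀ t, t ∉ Icc a b → χ t = 0) →
      ∫ t in Icc 0 T, (deriv χ t * g t + χ t * H t) = 0)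
    {t : ℝ} (ht : t ∈ Ioo 0 T) : HasDerivAt g (H t) t := by
  have hT : 0 < T := ht.1.trans ht.2
  set K : ℝ → ℝ := fun t => ∫ s in (0 : ℝ)..t, H s with hK
  have hKd : ∀ t, HasDerivAt K (H t) t := fun t => (hH.integral_hasStrictDerivAt 0 t).hasDerivAt
  have hKc : Continuous K := continuous_iff_continuousAt.2 fun t => (hKd t).continuousAt
  have hconst : ∀ s ∈ Ioo 0 T, (g s - K s) = g t - K t := fun s hs => by
    refine eqOn_const_of_integral_deriv_mul_eq_zero (hg.sub hKc) (fun χ hχ hsupp => ?_) hs ht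
    have h1 := hw χ hχ hsupp
    obtain ⟨a, b, ha, hb, hab⟩ := hsupp
    have hχc := hχ.continuous
    have hχ'c : Continuous (deriv χ) := hχ.continuous_deriv (by simp)
    have h2 : ∫ t in Icc 0 T, (deriv χ t * K t + χ t * H t) = 0 := by
      rw [integral_Icc_eq_integral_Ioc, ← intervalIntegral.integral_of_le hT.le,
        intervalIntegral.integral_eq_sub_of_hasDerivAt (f := fun t => χ t * K t)
          (fun x _ => ((hχ.differentiable (by simp) x).hasDerivAt.mul (hKd x)))
          ((by fun_prop : Continuous fun t => deriv χ t * K t + χ t * H t).intervalIntegrable _ _),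
        hab 0 (fun h => absurd h.1 (not_le.2 ha)), hab T (fun h => absurd h.2 (not_le.2 hb))]
      simp
    have hi : ∀ f : ℝ → ℝ, Continuous f → Integrable f (volume.restrict (Icc 0 T)) :=
      fun f hf => hf.continuousOn.integrableOn_Icc
    have h3 := integral_sub (hi _ (by fun_prop : Continuous fun t => deriv χ t * g t + χ t * H t))
      (hi _ (by fun_prop : Continuous fun t => deriv χ t * K t + χ t * H t))
    rw [h1, h2, sub_zero] at h3
    refine Eq.trans (integral_congr_ae (ae_of_all _ fun τ => ?_)) h3
    simp only [Pi.sub_apply]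
    ring
  refine ((hKd t).add_const (g t - K t)).congr_of_eventuallyEq ?_
  filter_upwards [isOpen_Ioo.mem_nhds ht] with s hs
  linarith [hconst s hs]

/-! ### Weak solutions as curves -/

/-- A continuous curve in `L²` of weakly divergence free fields, whose weak time derivative against
stationary test fields is given by the Euler equations on `(0, T)`. -/
structure IsEulerCurve (T : ℝ) (u : ℝ → E3 → E3) : Prop extends IsL2Curve u where
  hasDerivAt : ∀ w : E3 → E3, ContDiff ℝ ((⊤ : ℕ∞) : WithTop ℕ∞) w → IsPeriodic w →
    (∀ x, divergence w x = 0) → ∀ t ∈ Ioo 0 T,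
      HasDerivAt (fun s => ∫ x, inner ℝ (u s x) (w x) ∂torusMeasure)
        (∫ x, inner ℝ (u t x) (fderiv ℝ w x (u t x)) ∂torusMeasure) t
  divFree : ∀ q : E3 → ℝ, ContDiff ℝ ((⊤ : ℕ∞) : WithTop ℕ∞) q → IsPeriodic q →
    ∀ t ∈ Ioo 0 T, ∫ x, fderiv ℝ q x (u t x) ∂torusMeasure = 0

lemma IsL2Curve.continuous_integral_fderiv {u : ℝ → E3 → E3} (hu : IsL2Curve u) {q : E3 → ℝ}
    (hq : ContDiff ℝ ((⊤ : ℕ∞) : WithTop ℕ∞) q) (hp : IsPeriodic q) :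
    Continuous fun t => ∫ x, fderiv ℝ q x (u t x) ∂torusMeasure := by
  have hc : Continuous (gradient q) :=
    (InnerProductSpace.toDual ℝ E3).symm.continuous.comp (hq.continuous_fderiv (by simp))
  have hgp : IsPeriodic (gradient q) := fun x k => by
    rw [gradient, hp.fderiv x k, gradient]
  have hg : ∀ x e, inner ℝ e (gradient q x) = fderiv ℝ q x e := fun x e => by
    rw [real_inner_comm, gradient, InnerProductSpace.toDual_symm_apply]
  simpa only [hg] using hu.continuous_inner (memLp_of_continuous hc hgp)

lemma IsTestFunction.of_smul {F : Type*} [NormedAddCommGroup F] [NormedSpace ℝ F] {T : ℝ}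
    {χ : ℝ → ℝ} (hχ : ContDiff ℝ ((⊤ : ℕ∞) : WithTop ℕ∞) χ)
    (hsupp : ∃ a b, 0 < a ∧ b < T ∧ ∀ t, t ∉ Icc a b → χ t = 0) {w : E3 → F}
    (hw : ContDiff ℝ ((⊤ : ℕ∞) : WithTop ℕ∞) w) (hp : IsPeriodic w) :
    IsTestFunction T (fun t x => χ t • w x) := by
  refine ⟨(hχ.comp contDiff_fst).smul (hw.comp contDiff_snd), fun t x k => by simp only [hp x k], ?_⟩
  obtain ⟨a, b, ha, hb, h⟩ := hsupp
  exact ⟨a, b, ha, hb, fun t ht x => by rw [h t ht, zero_smul]⟩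

lemma isL2Curve_projIcc {T : ℝ} (hT : 0 < T) {v : ℝ → E3 → E3} (hv : MemC0L2 T v) :
    IsL2Curve (fun t => v (projIcc 0 T hT.le t)) := by
  refine ⟨fun t => (hv _ (projIcc 0 T hT.le t).2).1, fun t => ?_⟩
  have h1 := (hv _ (projIcc 0 T hT.le t).2).2
  have h2 : Tendsto (fun s => (projIcc 0 T hT.le s : ℝ)) (𝓝 t)
      (𝓝[Icc 0 T] (projIcc 0 T hT.le t : ℝ)) := by
    refine tendsto_nhdsWithin_iff.2 ⟨?_, Eventually.of_forall fun s => (projIcc 0 T hT.le s).2⟩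
    exact (continuous_subtype_val.comp continuous_projIcc).tendsto t
  have h3 := (ENNReal.tendsto_toReal ENNReal.zero_ne_top).comp (h1.comp h2)
  rw [ENNReal.toReal_zero] at h3
  exact h3

/-- The weak formulation is tested with products `χ(t) w(x)`. Freezing `v` outside `[0,T]` makes the
curve continuous on all of `ℝ` without affecting `(0,T)`. -/
lemma isEulerCurve_projIcc {T : ℝ} (hT : 0 < T) {v : ℝ → E3 → E3} (hv : IsWeakEulerSolution T v)
    (hc : MemC0L2 T v) : IsEulerCurve T (fun t => v (projIcc 0 T hT.le t)) := by
  have hu := isL2Curve_projIcc hT hc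
  have huv : ∀ t ∈ Icc 0 T, v (projIcc 0 T hT.le t) = v t := fun t ht => by
    rw [projIcc_of_mem hT.le ht]
  refine ⟨hu, fun w hw hp hdiv t ht => ?_, fun q hq hp t ht => ?_⟩
  · have hwc := hw.continuous_fderiv (by simp)
    have hH := (hu.continuous_quadratic (ι := Unit) (A := fun _ => fderiv ℝ w)
      (D := fun _ _ => 0) (fun _ => hwc) (fun _ => hp.fderiv) (by simp)
      (fun _ => tendsto_const_nhds)).comp (Continuous.prodMk_right ())
    refine hasDerivAt_of_weak_deriv (hu.continuous_inner (memLp_of_continuous hw.continuous hp)) hH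
      (fun χ hχ hsupp => ?_) ht
    have hfd : ∀ s x, fderiv ℝ (fun y => χ s • w y) x = χ s • fderiv ℝ w x := fun s x =>
      fderiv_fun_const_smul (hw.differentiable (by simp) x) _
    have h1 := hv.momentum _ (IsTestFunction.of_smul hχ hsupp hw hp) (fun s x => by
      have h0 := hdiv x
      rw [divergence] at h0 ⊢
      simp only [hfd, smul_apply, PiLp.smul_apply, smul_eq_mul, ← Finset.mul_sum, h0, mul_zero])
    refine Eq.trans ?_ h1
    refine setIntegral_congr_fun measurableSet_Icc fun s hs => ?_
    have e1 : ∀ x, deriv (fun s => χ s • w x) s = deriv χ s • w x := fun x =>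
      ((hχ.differentiable (by simp) s).hasDerivAt.smul_const (w x)).deriv
    simp only [hfd, e1, Function.comp, smul_apply, inner_smul_right, huv s hs]
    have hm := (hc s hs).1
    rw [integral_add, integral_const_mul, integral_const_mul]
    · exact (integrable_inner_of_memLp hm (memLp_of_continuous hw.continuous hp)).const_mul _
    · exact (integrable_inner_of_memLp hm (memLp_clm_apply hwc hp.fderiv hm)).const_mul _
  · have hH := hu.continuous_integral_fderiv hq hp
    -- The pairing with `∇q` is a weak derivative of the zero function, so it vanishes at every time
    -- and not only almost everywhere.
    have h0 := hasDerivAt_of_weak_deriv (T := T) (g := fun _ => 0) continuous_const hH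
      (fun χ hχ hsupp => ?_) ht
    · exact h0.unique (hasDerivAt_const t 0)
    · have h1 := hv.divFree _ (IsTestFunction.of_smul hχ hsupp hq hp)
      refine Eq.trans ?_ h1
      refine setIntegral_congr_fun measurableSet_Icc fun s hs => ?_
      have hfd : ∀ x, fderiv ℝ (fun y => χ s • q y) x = χ s • fderiv ℝ q x := fun x =>
        fderiv_fun_const_smul (hq.differentiable (by simp) x) _
      simp only [hfd, huv s hs, mul_zero, zero_add]
      simp only [smul_apply, smul_eq_mul, integral_const_mul]

/-! ### The mollified energy -/

lemma IsEulerCurve.divergence_mollify {T C r : ℝ} {u : ℝ → E3 → E3} (hu : IsEulerCurve T u)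
    {ρ : E3 → ℝ} (h : IsMollifier C r ρ) {t : ℝ} (ht : t ∈ Ioo 0 T) (x : E3) :
    ∫ y, fderiv ℝ ρ (y - x) (u t y) ∂torusMeasure = 0 := by
  have h1 := hu.divFree (fun y => ρ (y - x)) (h.smooth.comp (contDiff_id.sub contDiff_const))
    (fun y k => by simp only [add_sub_right_comm, h.periodic (y - x) k]) t ht
  simpa only [fderiv_comp_sub] using h1

lemma integrable_kernel_inner {k : E3 → ℝ} (hk : Continuous k) (hp : IsPeriodic k) {f g : E3 → E3}
    (hf : Integrable f torusMeasure) (hg : Integrable g torusMeasure) :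
    Integrable (fun z : E3 × E3 => k (z.2 - z.1) * inner ℝ (f z.1) (g z.2))
      (torusMeasure.prod torusMeasure) := by
  obtain ⟨M, -, hM⟩ := hp.exists_bound hk
  have h1 : Integrable (fun z : E3 × E3 => inner ℝ (f z.1) (g z.2))
      (torusMeasure.prod torusMeasure) :=
    (hf.norm.mul_prod hg.norm).mono' (hf.1.comp_fst.inner hg.1.comp_snd)
      (ae_of_all _ fun z => norm_inner_le_norm _ _)
  exact h1.bdd_mul (c := M)
    (hk.comp (by fun_prop : Continuous fun z : E3 × E3 => z.2 - z.1)).aestronglyMeasurable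
    (ae_of_all _ fun z => hM _)

lemma IsMollifier.integral_inner_mollify {C r : ℝ} {ρ : E3 → ℝ} (h : IsMollifier C r ρ)
    {f g : E3 → E3} (hf : Integrable f torusMeasure) (hg : Integrable g torusMeasure) :
    ∫ x, inner ℝ (f x) (mollify ρ g x) ∂torusMeasure =
      ∫ z : E3 × E3, ρ (z.2 - z.1) * inner ℝ (f z.1) (g z.2) ∂torusMeasure.prod torusMeasure := by
  rw [integral_prod _ (integrable_kernel_inner h.continuous h.periodic hf hg)]
  congr 1
  funext x
  rw [mollify, ← integral_inner (integrable_kernel_smul h.continuous h.periodic hg x)]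
  simp only [inner_smul_right]

/-- Mollification by an even kernel is self-adjoint. -/
lemma IsMollifier.integral_inner_mollify_comm {C r : ℝ} {ρ : E3 → ℝ} (h : IsMollifier C r ρ)
    {f g : E3 → E3} (hf : Integrable f torusMeasure) (hg : Integrable g torusMeasure) :
    ∫ x, inner ℝ (f x) (mollify ρ g x) ∂torusMeasure =
      ∫ x, inner ℝ (g x) (mollify ρ f x) ∂torusMeasure := by
  rw [h.integral_inner_mollify hf hg, h.integral_inner_mollify hg hf, ← integral_prod_swap]
  congr 1
  funext z
  simp only [Prod.fst_swap, Prod.snd_swap]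
  rw [h.sub_comm, real_inner_comm]

/-- The energy flux through the scale of the kernel `ρ`, with separate arguments for the
transported and the transporting time. -/
noncomputable def mollifiedFlux (ρ : E3 → ℝ) (u : ℝ → E3 → E3) (z : ℝ × ℝ) : ℝ :=
  ∫ x, inner ℝ (u z.2 x) (fderiv ℝ (mollify ρ (u z.1)) x (u z.2 x)) ∂torusMeasure

/-- The energy of the curve `u` mollified by the kernel `ρ`. -/
noncomputable def mollifiedEnergy (ρ : E3 → ℝ) (u : ℝ → E3 → E3) (t : ℝ) : ℝ :=
  ∫ x, inner ℝ (u t x) (mollify ρ (u t) x) ∂torusMeasure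

lemma IsMollifier.memLp_mollify {C r : ℝ} {ρ : E3 → ℝ} (h : IsMollifier C r ρ) {u : E3 → E3}
    (hu : Integrable u torusMeasure) : MemLp (mollify ρ u) 2 torusMeasure :=
  memLp_of_continuous (h.contDiff_mollify hu).continuous (h.isPeriodic_mollify u)

lemma IsL2Curve.continuous_mollifiedFlux {C r : ℝ} {u : ℝ → E3 → E3} (hu : IsL2Curve u)
    {ρ : E3 → ℝ} (h : IsMollifier C r ρ) : Continuous (mollifiedFlux ρ u) := by
  obtain ⟨M, hM0, hM⟩ := h.periodic.fderiv.exists_bound h.continuous_fderiv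
  refine hu.continuous_quadratic (A := fun t => fderiv ℝ (mollify ρ (u t)))
    (D := fun s t => M * torusL2 (u s - u t))
    (fun t => (h.contDiff_mollify (hu.integrable t)).continuous_fderiv (by simp))
    (fun t => (h.isPeriodic_mollify _).fderiv) (fun s t x => ?_) (fun t => ?_)
  · have hd := (hu.memLp s).sub (hu.memLp t)
    have i := fun s => integrable_smulRight h.continuous_fderiv h.periodic.fderiv
      (hu.integrable s) x
    rw [h.fderiv_mollify (hu.integrable s), h.fderiv_mollify (hu.integrable t), neg_sub_neg,
      ← integral_sub (i t) (i s)]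
    refine (norm_integral_le_of_norm_le ((hd.integrable one_le_two).norm.const_mul M)
      (ae_of_all _ fun y => ?_)).trans ?_
    · have e : (fderiv ℝ ρ (y - x)).smulRight (u t y) - (fderiv ℝ ρ (y - x)).smulRight (u s y)
          = (fderiv ℝ ρ (y - x)).smulRight (u t y - u s y) := by
        ext; simp [mul_sub]
      rw [e, ContinuousLinearMap.norm_smulRight_apply, norm_sub_rev (u t y)]
      exact mul_le_mul_of_nonneg_right (hM _) (norm_nonneg _)
    · rw [integral_const_mul]
      gcongr
      exact integral_norm_le hd
  · simpa using (hu.tendsto t).const_mul M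

/-- By self-adjointness the energy increment is the pairing of `u b - u a` with the sum of the two
mollified fields. That sum is a stationary, smooth, divergence free test field, so the mean value
theorem applies without any time regularity of `u` itself. -/
lemma IsEulerCurve.exists_slope_mollifiedEnergy {T C r : ℝ} {u : ℝ → E3 → E3}
    (hu : IsEulerCurve T u) {ρ : E3 → ℝ} (h : IsMollifier C r ρ) {a b : ℝ} (ha : a ∈ Ioo 0 T)
    (hb : b ∈ Ioo 0 T) (hab : a < b) :
    ∃ ξ ∈ Ioo a b, slope (mollifiedEnergy ρ u) a b =
      mollifiedFlux ρ u (a, ξ) + mollifiedFlux ρ u (b, ξ) := by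
  have hi := hu.integrable
  have hs := fun t => h.contDiff_mollify (hi t)
  have hdiv : ∀ t ∈ Ioo 0 T, ∀ x, divergence (mollify ρ (u t)) x = 0 := fun t ht x => by
    rw [h.divergence_mollify (hi t), hu.divergence_mollify h ht, neg_zero]
  have hdf := fun t => (hs t).differentiable (by simp)
  have hfd : ∀ x, fderiv ℝ (fun x => mollify ρ (u a) x + mollify ρ (u b) x) x =
      fderiv ℝ (mollify ρ (u a)) x + fderiv ℝ (mollify ρ (u b)) x := fun x =>
    fderiv_fun_add (hdf a x) (hdf b x)
  have hder := hu.hasDerivAt (fun x => mollify ρ (u a) x + mollify ρ (u b) x) ((hs a).add (hs b))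
    (fun x k => by simp only [h.isPeriodic_mollify _ x k]) (fun x => by
      have h1 := hdiv a ha x
      have h2 := hdiv b hb x
      rw [divergence] at h1 h2 ⊢
      simp only [hfd, add_apply, PiLp.add_apply, Finset.sum_add_distrib, h1, h2, add_zero])
  have hsub : Icc a b ⊆ Ioo 0 T := fun t ht => ⟨ha.1.trans_le ht.1, ht.2.trans_lt hb.2⟩
  obtain ⟨ξ, hξ, he⟩ := exists_hasDerivAt_eq_slope _ _ hab
    (fun t ht => (hder t (hsub ht)).continuousAt.continuousWithinAt)
    (fun t ht => hder t (hsub (Ioo_subset_Icc_self ht)))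
  refine ⟨ξ, hξ, ?_⟩
  have hw := fun t => h.memLp_mollify (hi t)
  have hm := hu.memLp
  have e1 : ∀ t, ∫ x, inner ℝ (u t x) (mollify ρ (u a) x + mollify ρ (u b) x) ∂torusMeasure =
      (∫ x, inner ℝ (u t x) (mollify ρ (u a) x) ∂torusMeasure) +
      ∫ x, inner ℝ (u t x) (mollify ρ (u b) x) ∂torusMeasure := fun t => by
    rw [← integral_add (integrable_inner_of_memLp (hm t) (hw a))
      (integrable_inner_of_memLp (hm t) (hw b))]
    simp only [inner_add_right]
  have e2 : mollifiedFlux ρ u (a, ξ) + mollifiedFlux ρ u (b, ξ) =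
      ∫ x, inner ℝ (u ξ x) (fderiv ℝ (fun x => mollify ρ (u a) x + mollify ρ (u b) x) x (u ξ x))
        ∂torusMeasure := by
    have i := fun t => integrable_inner_of_memLp (hm ξ) (memLp_clm_apply
      ((hs t).continuous_fderiv (by simp)) (h.isPeriodic_mollify (u t)).fderiv (hm ξ))
    rw [mollifiedFlux, mollifiedFlux, ← integral_add (i a) (i b)]
    simp only [hfd, add_apply, inner_add_right]
  rw [e2, he, e1, e1, slope_def_field, mollifiedEnergy, mollifiedEnergy,
    h.integral_inner_mollify_comm (hi a) (hi b)]
  congr 1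
  ring

/-- As `s → t` the intermediate time `ξ` is squeezed to `t`, and the flux is jointly continuous in
its two times. -/
lemma IsEulerCurve.hasDerivAt_mollifiedEnergy {T C r : ℝ} {u : ℝ → E3 → E3}
    (hu : IsEulerCurve T u) {ρ : E3 → ℝ} (h : IsMollifier C r ρ) {t : ℝ} (ht : t ∈ Ioo 0 T) :
    HasDerivAt (mollifiedEnergy ρ u) (2 * mollifiedFlux ρ u (t, t)) t := by
  rw [hasDerivAt_iff_tendsto_slope, Metric.tendsto_nhdsWithin_nhds]
  intro ε hε
  obtain ⟨δ, hδ, hδε⟩ := Metric.continuous_iff.1 (hu.continuous_mollifiedFlux h) (t, t) (ε / 2)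
    (half_pos hε)
  obtain ⟨δ', hδ', hδT⟩ := Metric.isOpen_iff.1 isOpen_Ioo t ht
  refine ⟨min δ δ', lt_min hδ hδ', fun s hs hst => ?_⟩
  have hsT : s ∈ Ioo 0 T := hδT (hst.trans_le (min_le_right _ _))
  have hsδ : dist s t < δ := hst.trans_le (min_le_left _ _)
  obtain ⟨ξ, hξ, he⟩ : ∃ ξ, dist ξ t < δ ∧ slope (mollifiedEnergy ρ u) t s =
      mollifiedFlux ρ u (t, ξ) + mollifiedFlux ρ u (s, ξ) := by
    rw [Real.dist_eq, abs_lt] at hsδ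
    rcases lt_or_gt_of_ne (show s ≠ t from hs) with hlt | hlt
    · obtain ⟨ξ, hξ, he⟩ := hu.exists_slope_mollifiedEnergy h hsT ht hlt
      refine ⟨ξ, ?_, by rw [slope_comm, he, add_comm]⟩
      rw [Real.dist_eq, abs_lt]
      constructor <;> linarith [hξ.1, hξ.2]
    · obtain ⟨ξ, hξ, he⟩ := hu.exists_slope_mollifiedEnergy h ht hsT hlt
      refine ⟨ξ, ?_, he⟩
      rw [Real.dist_eq, abs_lt]
      constructor <;> linarith [hξ.1, hξ.2]
  have h1 := hδε (t, ξ) (by rw [Prod.dist_eq, dist_self]; exact max_lt hδ hξ)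
  have h2 := hδε (s, ξ) (by rw [Prod.dist_eq]; exact max_lt hsδ hξ)
  rw [he]
  rw [Real.dist_eq] at *
  rw [abs_lt] at *
  constructor <;> linarith [h1.1, h1.2, h2.1, h2.2]

lemma IsEulerCurve.mollifiedEnergy_sub {T C r : ℝ} {u : ℝ → E3 → E3}
    (hu : IsEulerCurve T u) {ρ : E3 → ℝ} (h : IsMollifier C r ρ) {a b : ℝ} (ha : a ∈ Ioo 0 T)
    (hb : b ∈ Ioo 0 T) :
    mollifiedEnergy ρ u b - mollifiedEnergy ρ u a =
      ∫ t in a..b, 2 * mollifiedFlux ρ u (t, t) := by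
  have hc : Continuous fun t => 2 * mollifiedFlux ρ u (t, t) :=
    continuous_const.mul ((hu.continuous_mollifiedFlux h).comp (by fun_prop))
  rw [intervalIntegral.integral_eq_sub_of_hasDerivAt
    (fun t ht => hu.hasDerivAt_mollifiedEnergy h ?_) (hc.intervalIntegrable _ _)]
  exact ordConnected_Ioo.uIcc_subset ha hb ht

/-! ### The flux in terms of velocity increments -/

lemma integrable_prod_of_continuous {F : E3 × E3 → ℝ} (hF : Continuous F) :
    Integrable F (torusMeasure.prod torusMeasure) := by
  rw [torusMeasure, Measure.prod_restrict]
  refine (hF.continuousOn.integrableOn_compact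
    ((isCompact_closedBall (0 : E3) 2).prod (isCompact_closedBall (0 : E3) 2))).mono_set ?_
  exact prod_mono (fun x hx => mem_closedBall_zero_iff.2 (norm_le_two_of_mem_unitCell hx))
    (fun x hx => mem_closedBall_zero_iff.2 (norm_le_two_of_mem_unitCell hx))

/-- Expand the cubic expression in the increments. The terms `c₁`, `c₂` vanish because `∇ρ` has mean
zero, and `c₃`, `c₄` because `f` is weakly divergence free. What remains is `2a` plus `2a` with the
variables exchanged (`∇ρ` is odd), and `-∫ a` is the flux. -/
lemma IsMollifier.integral_flux_eq {C r : ℝ} {ρ : E3 → ℝ} (h : IsMollifier C r ρ) {f : E3 → E3}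
    (hf : Continuous f) (hi : Integrable f torusMeasure)
    (hdiv : ∀ x, ∫ y, fderiv ℝ ρ (y - x) (f y) ∂torusMeasure = 0) :
    ∫ x, inner ℝ (f x) (fderiv ℝ (mollify ρ f) x (f x)) ∂torusMeasure =
      -(1 / 4) * ∫ x, ∫ y, fderiv ℝ ρ (y - x) (f y - f x) * ‖f y - f x‖ ^ 2
        ∂torusMeasure ∂torusMeasure := by
  have hc := h.continuous_fderiv
  set μ := torusMeasure
  let a : E3 × E3 → ℝ := fun z => fderiv ℝ ρ (z.2 - z.1) (f z.1) * inner ℝ (f z.1) (f z.2)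
  let c₁ : E3 × E3 → ℝ := fun z => fderiv ℝ ρ (z.2 - z.1) (f z.2) * ‖f z.2‖ ^ 2
  let c₂ : E3 × E3 → ℝ := fun z => fderiv ℝ ρ (z.2 - z.1) (f z.1) * ‖f z.1‖ ^ 2
  let c₃ : E3 × E3 → ℝ := fun z => fderiv ℝ ρ (z.2 - z.1) (f z.2) * ‖f z.1‖ ^ 2
  let c₄ : E3 × E3 → ℝ := fun z => fderiv ℝ ρ (z.2 - z.1) (f z.1) * ‖f z.2‖ ^ 2
  let P : E3 × E3 → ℝ := fun z => fderiv ℝ ρ (z.2 - z.1) (f z.2 - f z.1) * ‖f z.2 - f z.1‖ ^ 2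
  have ia : Integrable a (μ.prod μ) := integrable_prod_of_continuous (by fun_prop)
  have i₁ : Integrable c₁ (μ.prod μ) := integrable_prod_of_continuous (by fun_prop)
  have i₂ : Integrable c₂ (μ.prod μ) := integrable_prod_of_continuous (by fun_prop)
  have i₃ : Integrable c₃ (μ.prod μ) := integrable_prod_of_continuous (by fun_prop)
  have i₄ : Integrable c₄ (μ.prod μ) := integrable_prod_of_continuous (by fun_prop)
  have iP : Integrable P (μ.prod μ) := integrable_prod_of_continuous (by fun_prop)
  have hodd : ∀ (y : E3) (g : E3 → E3), ∫ x, fderiv ℝ ρ (y - x) (g x) ∂μ =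
      -∫ x, fderiv ℝ ρ (x - y) (g x) ∂μ := fun y g => by
    rw [← integral_neg]
    congr 1
    funext x
    rw [h.fderiv_sub_comm y x, neg_apply]
  have z₁ : ∫ z, c₁ z ∂μ.prod μ = 0 := by
    rw [integral_prod_symm _ i₁]
    simp only [c₁, integral_mul_const, hodd _ (fun _ => f _), h.integral_fderiv_apply, neg_zero,
      zero_mul, integral_zero, μ]
  have z₂ : ∫ z, c₂ z ∂μ.prod μ = 0 := by
    rw [integral_prod _ i₂]
    simp only [c₂, integral_mul_const, h.integral_fderiv_apply, zero_mul, integral_zero, μ]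
  have z₃ : ∫ z, c₃ z ∂μ.prod μ = 0 := by
    rw [integral_prod _ i₃]
    simp only [c₃, integral_mul_const, hdiv, zero_mul, integral_zero]
  have z₄ : ∫ z, c₄ z ∂μ.prod μ = 0 := by
    rw [integral_prod_symm _ i₄]
    simp only [c₄, integral_mul_const, hodd _ f, hdiv, neg_zero, zero_mul, integral_zero]
  have hswap : ∫ z, a z.swap ∂μ.prod μ = ∫ z, a z ∂μ.prod μ := integral_prod_swap a
  have ha : ∫ x, inner ℝ (f x) (fderiv ℝ (mollify ρ f) x (f x)) ∂μ = -∫ z, a z ∂μ.prod μ := by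
    rw [integral_prod _ ia, ← integral_neg]
    congr 1
    funext x
    rw [h.fderiv_mollify_apply hi, inner_neg_right, ← integral_inner]
    · simp only [inner_smul_right, a, μ]
    · exact integrable_kernel_smul (k := fun z => fderiv ℝ ρ z (f x)) (by fun_prop)
        (fun z k => by simp only [h.periodic.fderiv z k]) hi x
  have hP : ∫ z, P z ∂μ.prod μ = 4 * ∫ z, a z ∂μ.prod μ := by
    have e : ∀ z, P z = ((c₁ z - c₂ z) + (c₃ z - c₄ z)) + (2 * a z + 2 * a z.swap) := fun z => by
      simp only [P, a, c₁, c₂, c₃, c₄, Prod.fst_swap, Prod.snd_swap, map_sub,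
        norm_sub_sq_real, h.fderiv_sub_comm z.1 z.2, neg_apply, real_inner_comm (f z.2) (f z.1)]
      ring
    have is : Integrable (fun z => a z.swap) (μ.prod μ) := ia.swap
    simp only [e]
    rw [integral_add (by exact (i₁.sub i₂).add (i₃.sub i₄))
        (by exact (ia.const_mul 2).add (is.const_mul 2)),
      integral_add (by exact i₁.sub i₂) (by exact i₃.sub i₄), integral_sub i₁ i₂, integral_sub i₃ i₄,
      integral_add (ia.const_mul 2) (is.const_mul 2), integral_const_mul, integral_const_mul,
      hswap, z₁, z₂, z₃, z₄]
    ring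
  rw [ha, ← integral_prod P iP, hP]
  ring

/-- The integral of the cubed increments of `f` against the gradient of the kernel. -/
noncomputable def cubicIncrement (ρ : E3 → ℝ) (f : E3 → E3) (x : E3) : ℝ≥0∞ :=
  ∫⁻ y, ‖fderiv ℝ ρ (y - x)‖ₑ * ‖f y - f x‖ₑ ^ 3 ∂torusMeasure

lemma IsMollifier.enorm_flux_le {C r : ℝ} {ρ : E3 → ℝ} (h : IsMollifier C r ρ) {f : E3 → E3}
    (hf : Continuous f) (hi : Integrable f torusMeasure)
    (hdiv : ∀ x, ∫ y, fderiv ℝ ρ (y - x) (f y) ∂torusMeasure = 0) :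
    ‖∫ x, inner ℝ (f x) (fderiv ℝ (mollify ρ f) x (f x)) ∂torusMeasure‖ₑ ≤
      ∫⁻ x, cubicIncrement ρ f x ∂torusMeasure := by
  rw [h.integral_flux_eq hf hi hdiv, enorm_mul]
  have h1 : ‖(-(1 / 4) : ℝ)‖ₑ ≤ 1 := by
    rw [← ofReal_norm, ← ENNReal.ofReal_one]
    exact ENNReal.ofReal_le_ofReal (by norm_num)
  refine (mul_le_of_le_one_left' h1).trans ((enorm_integral_le_lintegral_enorm _).trans ?_)
  refine lintegral_mono fun x => (enorm_integral_le_lintegral_enorm _).trans ?_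
  refine lintegral_mono fun y => ?_
  rw [enorm_mul, enorm_pow, enorm_norm, pow_succ' _ 2, ← mul_assoc]
  gcongr
  exact ContinuousLinearMap.le_opENorm _ _

/-! ### Fields that are regular off a closed set -/

/-- A `θ`-Hölder periodic field which is continuously differentiable off `S`, with a gradient
bounded by `K dist(x, S) ^ (θ - 1)`. -/
structure IsRegularOff (θ K : ℝ) (S : Set E3) (f : E3 → E3) : Prop where
  periodic : IsPeriodic f
  isClosed : IsClosed S
  const_nonneg : 0 ≤ K
  holder : ∀ x z, ‖f z - f x‖ ≤ K * ‖z - x‖ ^ θ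
  contDiffOn : ContDiffOn ℝ 1 f Sᶜ
  norm_fderiv_le : ∀ x ∈ Sᶜ, ‖fderiv ℝ f x‖ ≤ K * distTo x S ^ (θ - 1)

lemma IsRegularOff.continuous {θ K : ℝ} {S : Set E3} {f : E3 → E3} (hθ : 0 < θ)
    (hf : IsRegularOff θ K S f) : Continuous f := by
  rw [continuous_iff_continuousAt]
  intro x
  rw [ContinuousAt, tendsto_iff_norm_sub_tendsto_zero]
  refine squeeze_zero (fun _ => norm_nonneg _) (fun z => hf.holder x z) ?_
  have h : Tendsto (fun z => K * ‖z - x‖ ^ θ) (𝓝 x) (𝓝 (K * ‖x - x‖ ^ θ)) :=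
    ((((continuous_id.sub continuous_const).norm).rpow_const
      fun _ => Or.inr hθ.le).const_mul K).tendsto x
  simpa [hθ.ne'] using h

/-- The ball of radius `d / 2` about `x` stays at distance at least `d / 2` from `S`, so the mean
value inequality applies on it. -/
lemma IsRegularOff.norm_sub_le {θ K : ℝ} {S : Set E3} {f : E3 → E3} (hθ : θ ≤ 1)
    (hf : IsRegularOff θ K S f) {x z : E3} (hx : x ∉ S) (hz : ‖z - x‖ ≤ distTo x S / 2) :
    ‖f z - f x‖ ≤ K * (distTo x S / 2) ^ (θ - 1) * ‖z - x‖ := by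
  have hd := distTo_pos hf.isClosed hx
  have hle : ∀ y ∈ Metric.closedBall x (distTo x S / 2), distTo x S / 2 ≤ distTo y S :=
    fun y hy => half_distTo_le (by rwa [← mem_closedBall_iff_norm])
  have hmem : ∀ y ∈ Metric.closedBall x (distTo x S / 2), y ∈ Sᶜ := fun y hy =>
    notMem_of_distTo_pos ((half_pos hd).trans_le (hle y hy))
  refine (convex_closedBall x (distTo x S / 2)).norm_image_sub_le_of_norm_fderiv_le (𝕜 := ℝ)
    (fun y hy => ?_) (fun y hy => ?_) (Metric.mem_closedBall_self (half_pos hd).le)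
    (mem_closedBall_iff_norm.2 hz)
  · exact (hf.contDiffOn.contDiffAt (hf.isClosed.isOpen_compl.mem_nhds (hmem y hy))).differentiableAt
      one_ne_zero
  · refine (hf.norm_fderiv_le y (hmem y hy)).trans ?_
    exact mul_le_mul_of_nonneg_left
      (Real.rpow_le_rpow_of_nonpos (half_pos hd) (hle y hy) (by linarith)) hf.const_nonneg

/-- The support of `∇ρ` lies near the whole lattice; periodicity of `f` moves `y` into the ball of
radius `r` about `x`. -/
lemma IsMollifier.cubicIncrement_le {C r : ℝ} {ρ : E3 → ℝ} (h : IsMollifier C r ρ) {f : E3 → E3}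
    (hf : IsPeriodic f) {x : E3} {m : ℝ} (hm : ∀ z, ‖z - x‖ ≤ r → ‖f z - f x‖ ≤ m) :
    cubicIncrement ρ f x ≤ ENNReal.ofReal (C / r) * ENNReal.ofReal m ^ 3 := by
  have h1 : ∀ y, ‖fderiv ℝ ρ (y - x)‖ₑ * ‖f y - f x‖ₑ ^ 3 ≤
      ‖fderiv ℝ ρ (y - x)‖ₑ * ENNReal.ofReal m ^ 3 := fun y => by
    by_cases hy : fderiv ℝ ρ (y - x) = 0
    · rw [hy, ← ofReal_norm, norm_zero, ENNReal.ofReal_zero, zero_mul, zero_mul]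
    · obtain ⟨k, hk⟩ := h.support_fderiv _ hy
      gcongr
      rw [← ofReal_norm]
      refine ENNReal.ofReal_le_ofReal ?_
      rw [← hf.sub_latticeVec y k]
      exact hm _ (by rwa [sub_right_comm])
  refine (lintegral_mono h1).trans ?_
  rw [lintegral_mul_const']
  · gcongr
    rw [IsPeriodic.lintegral_comp_sub (f := fun y => ‖fderiv ℝ ρ y‖ₑ)
      (fun y k => by simp only [h.periodic.fderiv y k])]
    exact h.lintegral_fderiv
  · exact ENNReal.pow_ne_top ENNReal.ofReal_ne_top

/-- Three Lipschitz increments give `r³` against the `1 / r` from `∇ρ`; the surplus `r²` forces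
convergence to zero off `S`. -/
lemma IsMollifier.cubicIncrement_le_of_le {C r : ℝ} {ρ : E3 → ℝ} (h : IsMollifier C r ρ)
    (hC : 0 ≤ C) (hr : 0 < r) {θ K : ℝ} (hθ : θ ≤ 1) {S : Set E3} {f : E3 → E3}
    (hf : IsRegularOff θ K S f) {x : E3} (hx : x ∉ S) (hrx : r ≤ distTo x S / 2) :
    cubicIncrement ρ f x ≤
      ENNReal.ofReal (C * K ^ 3 * (distTo x S / 2) ^ (3 * (θ - 1)) * r ^ 2) := by
  have hd := half_pos (distTo_pos hf.isClosed hx)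
  have hK := hf.const_nonneg
  refine (h.cubicIncrement_le hf.periodic (m := K * (distTo x S / 2) ^ (θ - 1) * r)
    fun z hz => (hf.norm_sub_le hθ hx (hz.trans hrx)).trans (by gcongr)).trans (le_of_eq ?_)
  rw [← ENNReal.ofReal_pow (by positivity), ← ENNReal.ofReal_mul (by positivity)]
  congr 1
  rw [mul_comm 3, Real.rpow_mul hd.le, show ((3 : ℝ)) = ((3 : ℕ) : ℝ) by norm_num,
    Real.rpow_natCast]
  field_simp

lemma IsMollifier.cubicIncrement_le_rpow {C r : ℝ} {ρ : E3 → ℝ} (h : IsMollifier C r ρ)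
    (hC : 0 ≤ C) (hr : 0 < r) {θ K : ℝ} (hθ : θ ∈ Ioo (0 : ℝ) (1 / 3)) {S : Set E3} {f : E3 → E3}
    (hf : IsRegularOff θ K S f) {x : E3} (hx : x ∉ S) :
    cubicIncrement ρ f x ≤
      ENNReal.ofReal (C * K ^ 3) * ENNReal.ofReal ((distTo x S / 2) ^ (-(1 - 3 * θ))) := by
  have hd := half_pos (distTo_pos hf.isClosed hx)
  have hK := hf.const_nonneg
  obtain ⟨hθ0, hθ1⟩ := hθ
  rw [← ENNReal.ofReal_mul (by positivity)]
  -- Below `d / 2`, `r²` is traded for `(d/2)²`. Above it the Hölder bound gives `r^(3θ-1)`, and the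
  -- exponent is negative since `θ < 1/3`.
  rcases le_or_gt r (distTo x S / 2) with hrx | hrx
  · refine (h.cubicIncrement_le_of_le hC hr (by linarith) hf hx hrx).trans
      (ENNReal.ofReal_le_ofReal ?_)
    rw [show -(1 - 3 * θ) = 3 * (θ - 1) + (2 : ℕ) by push_cast; ring, Real.rpow_add hd,
      Real.rpow_natCast, ← mul_assoc]
    gcongr
  · refine (h.cubicIncrement_le hf.periodic (m := K * r ^ θ)
      fun z hz => (hf.holder x z).trans (by gcongr)).trans ?_
    rw [← ENNReal.ofReal_pow (by positivity), ← ENNReal.ofReal_mul (by positivity)]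
    refine ENNReal.ofReal_le_ofReal ?_
    have e : C / r * (K * r ^ θ) ^ 3 = C * K ^ 3 * r ^ (-(1 - 3 * θ)) := by
      rw [show -(1 - 3 * θ) = θ * (3 : ℕ) - 1 by push_cast; ring, Real.rpow_sub hr, Real.rpow_mul hr.le,
        Real.rpow_natCast, Real.rpow_one]
      field_simp
    rw [e]
    exact mul_le_mul_of_nonneg_left (Real.rpow_le_rpow_of_nonpos hd hrx.le (by linarith))
      (by positivity)

lemma measurable_cubicIncrement {ρ : E3 → ℝ} (hρ : Continuous (fderiv ℝ ρ)) {f : E3 → E3}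
    (hf : Continuous f) : Measurable (cubicIncrement ρ f) := by
  have h : Continuous fun z : E3 × E3 => ‖fderiv ℝ ρ (z.2 - z.1)‖ₑ * ‖f z.2 - f z.1‖ₑ ^ 3 := by
    have h1 : Continuous fun z : E3 × E3 => ENNReal.ofReal
        (‖fderiv ℝ ρ (z.2 - z.1)‖ * ‖f z.2 - f z.1‖ ^ 3) :=
      ENNReal.continuous_ofReal.comp (by fun_prop)
    refine h1.congr fun z => ?_
    rw [ENNReal.ofReal_mul (norm_nonneg _), ENNReal.ofReal_pow (norm_nonneg _), ofReal_norm,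
      ofReal_norm]
  exact h.measurable.lintegral_prod_right'

lemma IsRegularOff.lintegral_cubicIncrement_le {C r : ℝ} {ρ : E3 → ℝ} (h : IsMollifier C r ρ)
    (hC : 0 ≤ C) (hr : 0 < r) {θ K : ℝ} (hθ : θ ∈ Ioo (0 : ℝ) (1 / 3)) {S : Set E3} {f : E3 → E3}
    (hf : IsRegularOff θ K S f) (hS : torusMeasure S = 0) :
    ∫⁻ x, cubicIncrement ρ f x ∂torusMeasure ≤ ENNReal.ofReal (C * K ^ 3) *
      ∫⁻ x, ENNReal.ofReal ((distTo x S / 2) ^ (-(1 - 3 * θ))) ∂torusMeasure := by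
  rw [← lintegral_const_mul' _ _ ENNReal.ofReal_ne_top]
  refine lintegral_mono_ae ?_
  filter_upwards [compl_mem_ae_iff.2 hS] with x hx
  exact h.cubicIncrement_le_rpow hC hr hθ hf hx

lemma IsRegularOff.tendsto_lintegral_cubicIncrement {C : ℝ} (hC : 0 ≤ C) {r : ℕ → ℝ}
    (hr : ∀ n, 0 < r n) (hr0 : Tendsto r atTop (𝓝 0)) {ρ : ℕ → E3 → ℝ}
    (h : ∀ n, IsMollifier C (r n) (ρ n)) {θ K : ℝ} (hθ : θ ∈ Ioo (0 : ℝ) (1 / 3)) {S : Set E3}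
    {f : E3 → E3} (hf : IsRegularOff θ K S f) (hS : torusMeasure S = 0)
    (hfin : ∫⁻ x, ENNReal.ofReal ((distTo x S / 2) ^ (-(1 - 3 * θ))) ∂torusMeasure ≠ ∞) :
    Tendsto (fun n => ∫⁻ x, cubicIncrement (ρ n) f x ∂torusMeasure) atTop (𝓝 0) := by
  rw [← lintegral_zero (α := E3) (μ := torusMeasure)]
  refine tendsto_lintegral_of_dominated_convergence (fun x => ENNReal.ofReal (C * K ^ 3) *
      ENNReal.ofReal ((distTo x S / 2) ^ (-(1 - 3 * θ))))
    (fun n => measurable_cubicIncrement (h n).continuous_fderiv (hf.continuous hθ.1))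
    (fun n => ?_) ?_ ?_
  · filter_upwards [compl_mem_ae_iff.2 hS] with x hx
    exact (h n).cubicIncrement_le_rpow hC (hr n) hθ hf hx
  · rw [lintegral_const_mul' _ _ ENNReal.ofReal_ne_top]
    exact ENNReal.mul_ne_top ENNReal.ofReal_ne_top hfin
  · filter_upwards [compl_mem_ae_iff.2 hS] with x hx
    have hd := half_pos (distTo_pos hf.isClosed hx)
    have hlim : Tendsto (fun n => ENNReal.ofReal
        (C * K ^ 3 * (distTo x S / 2) ^ (3 * (θ - 1)) * r n ^ 2)) atTop (𝓝 0) := by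
      have := ENNReal.tendsto_ofReal ((hr0.pow 2).const_mul
        (C * K ^ 3 * (distTo x S / 2) ^ (3 * (θ - 1))))
      simpa using this
    refine tendsto_of_tendsto_of_tendsto_of_le_of_le' tendsto_const_nhds hlim
      (Eventually.of_forall fun n => zero_le) ?_
    filter_upwards [hr0.eventually_le_const hd] with n hn
    exact (h n).cubicIncrement_le_of_le hC (hr n) (by linarith [hθ.2]) hf hx hn

/-- Hölder continuity makes the mollification converge uniformly, with error `K r^θ`. -/
lemma IsRegularOff.tendsto_integral_mollify {C : ℝ} {r : ℕ → ℝ} (hr0 : Tendsto r atTop (𝓝 0))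
    {ρ : ℕ → E3 → ℝ} (h : ∀ n, IsMollifier C (r n) (ρ n)) {θ K : ℝ} (hθ : 0 < θ) {S : Set E3}
    {f : E3 → E3} (hf : IsRegularOff θ K S f) :
    Tendsto (fun n => ∫ x, inner ℝ (f x) (mollify (ρ n) f x) ∂torusMeasure) atTop
      (𝓝 (∫ x, ‖f x‖ ^ 2 ∂torusMeasure)) := by
  have hm := memLp_of_continuous (hf.continuous hθ) hf.periodic
  have hi := hm.integrable one_le_two
  have hK := hf.const_nonneg
  have hle : ∀ n x, ‖mollify (ρ n) f x - f x‖ ≤ K * r n ^ θ := fun n x => by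
    have hp := h n
    have i1 : Integrable (fun y => ρ n (y - x)) torusMeasure := by
      simpa using integrable_kernel_smul hp.continuous hp.periodic (integrable_const (1 : ℝ)) x
    have h1 : ∫ y, ρ n (y - x) ∂torusMeasure = 1 := by
      rw [hp.periodic.integral_comp_sub, hp.integral_eq_one]
    have e : mollify (ρ n) f x - f x = ∫ y, ρ n (y - x) • (f y - f x) ∂torusMeasure := by
      simp only [smul_sub]
      rw [integral_sub (integrable_kernel_smul hp.continuous hp.periodic hi x)
        (i1.smul_const (f x)), integral_smul_const, h1, one_smul, mollify]
    rw [e]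
    calc _ ≤ ∫ y, ρ n (y - x) * (K * r n ^ θ) ∂torusMeasure := by
          refine norm_integral_le_of_norm_le (i1.mul_const _) (ae_of_all _ fun y => ?_)
          rw [norm_smul, Real.norm_of_nonneg (hp.nonneg _)]
          by_cases h0 : ρ n (y - x) = 0
          · rw [h0, zero_mul, zero_mul]
          · obtain ⟨k, hk⟩ := hp.support _ h0
            refine mul_le_mul_of_nonneg_left ?_ (hp.nonneg _)
            rw [← hf.periodic.sub_latticeVec y k]
            refine (hf.holder _ _).trans ?_
            rw [sub_right_comm] at hk
            gcongr
      _ = K * r n ^ θ := by rw [integral_mul_const, h1, one_mul]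
  rw [tendsto_iff_dist_tendsto_zero]
  have hlim : Tendsto (fun n => (∫ x, ‖f x‖ ∂torusMeasure) * (K * r n ^ θ)) atTop (𝓝 0) := by
    have h1 := ((hr0.rpow_const (p := θ) (Or.inr hθ.le)).const_mul K).const_mul
      (∫ x, ‖f x‖ ∂torusMeasure)
    simpa [Real.zero_rpow hθ.ne'] using h1
  refine squeeze_zero (fun _ => dist_nonneg) (fun n => ?_) hlim
  have hsq : ∀ x, ‖f x‖ ^ 2 = inner ℝ (f x) (f x) := fun x => (real_inner_self_eq_norm_sq _).symm
  simp only [hsq]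
  rw [Real.dist_eq, ← integral_sub (integrable_inner_of_memLp hm ((h n).memLp_mollify hi))
    (integrable_inner_of_memLp hm hm), ← integral_mul_const, ← Real.norm_eq_abs]
  refine norm_integral_le_of_norm_le (hi.norm.mul_const _) (ae_of_all _ fun x => ?_)
  rw [← inner_sub_right]
  refine (norm_inner_le_norm _ _).trans ?_
  gcongr
  exact hle n x

/-! ### Negative powers of the distance -/

/-- Dyadic decomposition: if `2^(-n-1) < d ≤ 2^(-n)`, then `x` lies in the neighbourhood of radius
`2^(-n)` and `d / 2 > 2^(-n) / 4`. The condition `1 ≤ m` keeps the value `1` assigned to the empty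
set out of the dyadic range. -/
lemma ofReal_distTo_rpow_le {q : ℝ} (hq : 0 < q) {m : ℕ} (hm : 1 ≤ m) (S : Set E3) (x : E3) :
    ENNReal.ofReal ((distTo x S / 2) ^ (-q)) ≤
      ENNReal.ofReal (((1 / 2) ^ m / 2) ^ (-q)) +
        ∑' j : ℕ, (Metric.cthickening ((1 / 2) ^ (m + j)) S).indicator
          (fun _ => ENNReal.ofReal (((1 / 2 : ℝ) ^ (m + j) / 4) ^ (-q))) x := by
  have hd0 : 0 ≤ distTo x S := by
    rw [distTo]; split_ifs
    · exact zero_le_one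
    · exact Metric.infDist_nonneg
  rcases hd0.eq_or_lt with hd | hd
  -- At distance zero the real power takes the default value `0`, so the bound is trivial there.
  · rw [← hd, zero_div, Real.zero_rpow (neg_ne_zero.2 hq.ne'), ENNReal.ofReal_zero]
    exact zero_le
  have hm0 : (0 : ℝ) < (1 / 2) ^ m := by positivity
  rcases le_or_gt ((1 / 2 : ℝ) ^ m) (distTo x S) with hdm | hdm
  · refine le_add_right (ENNReal.ofReal_le_ofReal ?_)
    exact Real.rpow_le_rpow_of_nonpos (by positivity) (by gcongr) (by linarith)
  have hm1 : (1 / 2 : ℝ) ^ m ≤ 1 / 2 := by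
    simpa using pow_le_pow_of_le_one (by norm_num : (0 : ℝ) ≤ 1 / 2) (by norm_num) hm
  obtain ⟨n, hn1, hn2⟩ := exists_nat_pow_near_of_lt_one hd (by linarith)
    (by norm_num : (0 : ℝ) < 1 / 2) (by norm_num)
  have hmn : m ≤ n := by
    have := (pow_lt_pow_iff_right_of_lt_one₀ (by norm_num : (0 : ℝ) < 1 / 2) (by norm_num)).1
      (hn1.trans hdm)
    omega
  obtain ⟨j, rfl⟩ := Nat.exists_eq_add_of_le hmn
  refine le_add_left (le_trans ?_ (ENNReal.le_tsum j))
  have hne : S ≠ ∅ := fun h => by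
    rw [distTo, if_pos h] at hdm; linarith
  have hmem : x ∈ Metric.cthickening ((1 / 2) ^ (m + j)) S := by
    rw [distTo, if_neg hne] at hn2
    rw [Metric.mem_cthickening_iff]
    exact ENNReal.le_ofReal_iff_toReal_le (Metric.infEDist_ne_top (nonempty_iff_ne_empty.2 hne))
      (by positivity) |>.2 hn2
  rw [indicator_of_mem hmem]
  refine ENNReal.ofReal_le_ofReal
    (Real.rpow_le_rpow_of_nonpos (by positivity) ?_ (by linarith))
  rw [pow_succ] at hn1
  linarith

/-- The dyadic terms form a geometric series of ratio `2^(-(β - q)) < 1`. The bound depends only on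
`q`, `β`, `m`, so it is uniform over all times. -/
lemma exists_lintegral_distTo_rpow_le {q β : ℝ} (hq : 0 < q) (hβ : q < β) {m : ℕ} (hm : 1 ≤ m) :
    ∃ M : ℝ≥0∞, M ≠ ∞ ∧ ∀ S : Set E3,
      (∀ j : ℕ, torusMeasure (Metric.cthickening ((1 / 2) ^ (m + j)) S) ≤
        ENNReal.ofReal ((2 * (1 / 2) ^ (m + j)) ^ β)) →
      ∫⁻ x, ENNReal.ofReal ((distTo x S / 2) ^ (-q)) ∂torusMeasure ≤ M := by
  have hterm : ∀ j : ℕ, ((1 / 2 : ℝ) ^ (m + j) / 4) ^ (-q) * (2 * (1 / 2) ^ (m + j)) ^ β =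
      4 ^ q * 2 ^ β * ((1 / 2 : ℝ) ^ m) ^ (β - q) * ((1 / 2 : ℝ) ^ (β - q)) ^ j := fun j => by
    have hp : (0 : ℝ) < (1 / 2) ^ (m + j) := by positivity
    have h1 : ((1 / 2 : ℝ) ^ (m + j)) ^ (β - q) =
        ((1 / 2 : ℝ) ^ m) ^ (β - q) * ((1 / 2 : ℝ) ^ (β - q)) ^ j := by
      rw [pow_add, Real.mul_rpow (by positivity) (by positivity), Real.rpow_pow_comm (by norm_num)]
    rw [mul_assoc _ (((1 / 2 : ℝ) ^ m) ^ (β - q)), ← h1, Real.div_rpow hp.le (by norm_num),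
      Real.mul_rpow zero_le_two hp.le, Real.rpow_sub hp, Real.rpow_neg hp.le,
      Real.rpow_neg (by norm_num)]
    field_simp
  set b : ℕ → ℝ := fun j =>
    4 ^ q * 2 ^ β * ((1 / 2 : ℝ) ^ m) ^ (β - q) * ((1 / 2 : ℝ) ^ (β - q)) ^ j with hb
  have hsum : Summable b := (summable_geometric_of_lt_one (by positivity)
    (Real.rpow_lt_one (by norm_num) (by norm_num) (by linarith))).mul_left _
  refine ⟨ENNReal.ofReal (((1 / 2) ^ m / 2) ^ (-q)) + ∑' j, ENNReal.ofReal (b j),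
    ENNReal.add_ne_top.2 ⟨ENNReal.ofReal_ne_top, ?_⟩, fun S hS => ?_⟩
  · rw [← ENNReal.ofReal_tsum_of_nonneg (fun j => by positivity) hsum]
    exact ENNReal.ofReal_ne_top
  refine (lintegral_mono (ofReal_distTo_rpow_le hq hm S)).trans ?_
  rw [lintegral_add_left measurable_const, lintegral_const, measure_univ, mul_one,
    lintegral_tsum fun j => (measurable_const.indicator
      Metric.isClosed_cthickening.measurableSet).aemeasurable]
  gcongr with j
  rw [lintegral_indicator_const Metric.isClosed_cthickening.measurableSet, hb]
  simp only
  rw [← hterm, ENNReal.ofReal_mul (by positivity)]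
  gcongr
  exact hS j

lemma torusMeasure_eq_zero_of_cthickening_le {β : ℝ} (hβ : 0 < β) {m : ℕ} {S : Set E3}
    (hS : ∀ j : ℕ, torusMeasure (Metric.cthickening ((1 / 2) ^ (m + j)) S) ≤
        ENNReal.ofReal ((2 * (1 / 2) ^ (m + j)) ^ β)) : torusMeasure S = 0 := by
  have h0 : Tendsto (fun j : ℕ => (1 / 2 : ℝ) ^ (m + j)) atTop (𝓝 0) := by
    simpa [pow_add] using (tendsto_pow_atTop_nhds_zero_of_lt_one (by norm_num : (0 : ℝ) ≤ 1 / 2)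
      (by norm_num)).const_mul ((1 / 2 : ℝ) ^ m)
  have h1 : Tendsto (fun j : ℕ => ENNReal.ofReal ((2 * (1 / 2 : ℝ) ^ (m + j)) ^ β)) atTop
      (𝓝 0) := by
    have := ENNReal.tendsto_ofReal ((h0.const_mul 2).rpow_const (p := β) (Or.inr hβ.le))
    simpa [Real.zero_rpow hβ.ne'] using this
  refine le_antisymm (ge_of_tendsto' h1 fun j => ?_) zero_le
  exact (measure_mono (Metric.self_subset_cthickening S)).trans (hS j)

/-- Sampling at dyadic radii leaves countably many almost-everywhere conditions, hence a single
exceptional null set of times. -/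
lemma exists_forall_cthickening_le {T s : ℝ} {S : ℝ → Set E3}
    (h : uniformMinkowskiContent T s S = 0) :
    ∃ m : ℕ, 1 ≤ m ∧ ∀ᵐ t ∂(volume.restrict (Icc 0 T)), ∀ j : ℕ,
      torusMeasure (Metric.cthickening ((1 / 2) ^ (m + j)) (S t)) ≤
        ENNReal.ofReal ((2 * (1 / 2) ^ (m + j)) ^ (3 - s)) := by
  have h1 := eventually_lt_of_limsup_lt (h.trans_lt one_pos)
  have h0 : Tendsto (fun j : ℕ => (1 / 2 : ℝ) ^ j) atTop (𝓝[>] 0) :=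
    tendsto_nhdsWithin_iff.2 ⟨tendsto_pow_atTop_nhds_zero_of_lt_one (by norm_num) (by norm_num),
      Eventually.of_forall fun j => by simp⟩
  obtain ⟨m, hm⟩ := eventually_atTop.1 (h0.eventually h1)
  refine ⟨m + 1, by omega, ae_all_iff.2 fun j => ?_⟩
  filter_upwards [ae_lt_of_essSup_lt (hm (m + 1 + j) (by omega))] with t ht
  have hp : (0 : ℝ) < 2 * (1 / 2) ^ (m + 1 + j) := by positivity
  rw [← neg_sub s 3, Real.rpow_neg hp.le, ENNReal.ofReal_inv_of_pos (by positivity)]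
  rw [mul_comm] at ht
  exact ENNReal.le_inv_iff_mul_le.2 ht.le

/-! ### Conservation of energy -/

lemma norm_sub_le_holderENorm_mul {θ : ℝ} (hθ : 0 ≤ θ) {f : E3 → E3} (hf : holderENorm θ f ≠ ∞)
    (x z : E3) : ‖f z - f x‖ ≤ (holderENorm θ f).toReal * ‖z - x‖ ^ θ := by
  have h1 : eHolderNorm θ.toNNReal f ≠ ∞ := ne_top_of_le_ne_top hf le_add_self
  have h2 : HolderWith (nnHolderNorm θ.toNNReal f) θ.toNNReal f :=
    (eHolderNorm_lt_top.1 h1.lt_top).holderWith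
  have h3 := h2.dist_le z x
  rw [dist_eq_norm, dist_eq_norm, Real.coe_toNNReal _ hθ] at h3
  refine h3.trans ?_
  gcongr
  exact ENNReal.toReal_mono hf le_add_self

lemma isRegularOff_of_bounds {θ κ c : ℝ} (hθ : 0 ≤ θ) (hκ : κ ≤ 1 - θ) {S : Set E3} {f : E3 → E3}
    (hp : IsPeriodic f) (hf : holderENorm θ f ≠ ∞) (hS : IsClosed S) (hSp : IsPeriodicSet S)
    (hd : ContDiffOn ℝ 1 f Sᶜ) (hg : ∀ x ∈ Sᶜ, ‖fderiv ℝ f x‖ ≤ c * distTo x S ^ (-κ)) :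
    IsRegularOff θ (max (holderENorm θ f).toReal |c|) S f := by
  -- The absolute value is needed since `c` is not assumed nonnegative.
  refine ⟨hp, hS, le_max_of_le_right (abs_nonneg c), fun x z => ?_, hd, fun x hx => ?_⟩
  · refine (norm_sub_le_holderENorm_mul hθ hf x z).trans ?_
    gcongr
    exact le_max_left _ _
  · have hpos := distTo_pos hS hx
    refine (hg x hx).trans (mul_le_mul ((le_abs_self c).trans (le_max_right _ _)) ?_
      (by positivity) (le_max_of_le_right (abs_nonneg c)))
    exact Real.rpow_le_rpow_of_exponent_ge hpos (distTo_le_one hSp x) (by linarith)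

lemma ofReal_max_pow_le {a : ℝ≥0∞} {b : ℝ} :
    ENNReal.ofReal (max a.toReal |b|) ^ 3 ≤ a ^ 3 + ‖b‖ₑ ^ 3 := by
  rw [ENNReal.ofReal_max, ← Real.norm_eq_abs, ofReal_norm]
  rcases le_total (ENNReal.ofReal a.toReal) ‖b‖ₑ with h | h
  · rw [max_eq_right h]
    exact le_add_self
  · rw [max_eq_left h]
    refine le_add_right ?_
    gcongr
    exact ENNReal.ofReal_toReal_le

lemma lintegral_enorm_pow_three_ne_top {α ε : Type*} [MeasurableSpace α] {μ : Measure α}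
    [TopologicalSpace ε] [ContinuousENorm ε] {f : α → ε} (hf : MemLp f 3 μ) :
    ∫⁻ t, ‖f t‖ₑ ^ 3 ∂μ ≠ ∞ := by
  have h := (eLpNorm_lt_top_iff_lintegral_rpow_enorm_lt_top (by norm_num) (by norm_num)).1 hf.2
  have e : ((3 : ℝ≥0∞)).toReal = ((3 : ℕ) : ℝ) := by simp
  simp only [e, ENNReal.rpow_natCast] at h
  exact h.ne

lemma integral_norm_sq_eq {f : E3 → E3} (hf : MemLp f 2 torusMeasure) :
    ∫ x, ‖f x‖ ^ 2 ∂torusMeasure = torusL2 f ^ 2 := by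
  rw [torusL2, hf.eLpNorm_eq_integral_rpow_norm (by norm_num) (by norm_num)]
  have h0 : 0 ≤ ∫ x, ‖f x‖ ^ 2 ∂torusMeasure := integral_nonneg fun x => by positivity
  simp only [ENNReal.toReal_ofNat, Real.rpow_ofNat]
  rw [ENNReal.toReal_ofReal (by positivity), ← Real.rpow_natCast, ← Real.rpow_mul h0]
  norm_num

/-- The flux tends to zero in `L¹(0,T)`, so differences of mollified energies tend to zero, while at
almost every time these energies converge to the true one. Domination asks only that `b` have finite
integral and majorise the cube of `K`; `K` and `M` need no regularity in time. -/
lemma IsEulerCurve.energy_eq_of_isRegularOff {T θ : ℝ} (hθ : θ ∈ Ioo (0 : ℝ) (1 / 3))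
    {u : ℝ → E3 → E3} (hu : IsEulerCurve T u) {S : ℝ → Set E3} {K : ℝ → ℝ} {b : ℝ → ℝ≥0∞}
    (hb : ∫⁻ t in Ioo 0 T, b t ≠ ∞) (hKb : ∀ t, ENNReal.ofReal (K t) ^ 3 ≤ b t)
    {M : ℝ≥0∞} (hM : M ≠ ∞)
    (hreg : ∀ᵐ t ∂(volume.restrict (Ioo 0 T)), IsRegularOff θ (K t) (S t) (u t) ∧
      torusMeasure (S t) = 0 ∧
      ∫⁻ x, ENNReal.ofReal ((distTo x (S t) / 2) ^ (-(1 - 3 * θ))) ∂torusMeasure ≤ M) :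
    ∃ E : ℝ, ∀ᵐ t ∂(volume.restrict (Ioo 0 T)), ∫ x, ‖u t x‖ ^ 2 ∂torusMeasure = E := by
  obtain ⟨C, hC, hker⟩ := exists_isMollifier
  set r : ℕ → ℝ := fun n => 1 / ((n : ℝ) + 1) with hr
  have hr_pos : ∀ n, 0 < r n := fun n => Nat.one_div_pos_of_nat
  have hr_le : ∀ n, r n ≤ 1 := fun n => by
    rw [hr]
    exact div_le_one_of_le₀ (by simp) (by positivity)
  have hr0 : Tendsto r atTop (𝓝 0) := tendsto_one_div_add_atTop_nhds_zero_nat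
  choose ρ hρ using fun n => hker (r n) (hr_pos n) (hr_le n)
  have hflux : ∀ᵐ t ∂(volume.restrict (Ioo 0 T)), ∀ n,
      ‖mollifiedFlux (ρ n) u (t, t)‖ₑ ≤ ∫⁻ x, cubicIncrement (ρ n) (u t) x ∂torusMeasure := by
    filter_upwards [hreg, ae_restrict_mem measurableSet_Ioo] with t ht htT n
    exact (hρ n).enorm_flux_le (ht.1.continuous hθ.1) (hu.integrable t)
      (hu.divergence_mollify (hρ n) htT)
  have hlim : Tendsto (fun n => ∫⁻ t in Ioo 0 T, ‖mollifiedFlux (ρ n) u (t, t)‖ₑ) atTop (𝓝 0) := by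
    rw [← lintegral_zero (μ := volume.restrict (Ioo 0 T))]
    refine tendsto_lintegral_of_dominated_convergence (fun t => ENNReal.ofReal C * M * b t)
      (fun n => ?_) (fun n => ?_) ?_ ?_
    · exact ((hu.continuous_mollifiedFlux (hρ n)).comp
        (by fun_prop : Continuous fun t : ℝ => (t, t))).enorm.measurable
    · filter_upwards [hflux, hreg] with t h1 h2
      refine (h1 n).trans ((h2.1.lintegral_cubicIncrement_le (hρ n) hC.le (hr_pos n) hθ
        h2.2.1).trans ?_)
      rw [ENNReal.ofReal_mul hC.le, ENNReal.ofReal_pow h2.1.const_nonneg, mul_right_comm]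
      gcongr
      · exact h2.2.2
      · exact hKb t
    · rw [lintegral_const_mul' _ _ (ENNReal.mul_ne_top ENNReal.ofReal_ne_top hM)]
      exact ENNReal.mul_ne_top (ENNReal.mul_ne_top ENNReal.ofReal_ne_top hM) hb
    · filter_upwards [hflux, hreg] with t h1 h2
      exact tendsto_of_tendsto_of_tendsto_of_le_of_le tendsto_const_nhds
        (h2.1.tendsto_lintegral_cubicIncrement hC.le hr_pos hr0 hρ hθ h2.2.1
          (ne_top_of_le_ne_top hM h2.2.2)) (fun n => zero_le) h1
  by_cases hT : T ≤ 0
  · exact ⟨0, by simp [Ioo_eq_empty_of_le hT]⟩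
  -- Needed to pick a reference time `a` in the set of good times.
  have hne : (ae (volume.restrict (Ioo 0 T))).NeBot := by
    rw [ae_neBot, ne_eq, Measure.restrict_eq_zero, Real.volume_Ioo, ENNReal.ofReal_eq_zero]
    linarith
  have hgood : ∀ᵐ t ∂(volume.restrict (Ioo 0 T)), t ∈ Ioo 0 T ∧
      Tendsto (fun n => mollifiedEnergy (ρ n) u t) atTop (𝓝 (∫ x, ‖u t x‖ ^ 2 ∂torusMeasure)) := by
    filter_upwards [hreg, ae_restrict_mem measurableSet_Ioo] with t ht htT
    exact ⟨htT, ht.1.tendsto_integral_mollify hr0 hρ hθ.1⟩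
  obtain ⟨a, haT, ha⟩ := hgood.exists
  refine ⟨∫ x, ‖u a x‖ ^ 2 ∂torusMeasure, ?_⟩
  filter_upwards [hgood] with t ht
  obtain ⟨htT, ht⟩ := ht
  have h1 := ht.sub ha
  have h2 : Tendsto (fun n => mollifiedEnergy (ρ n) u t - mollifiedEnergy (ρ n) u a) atTop
      (𝓝 0) := by
    rw [tendsto_zero_iff_enorm_tendsto_zero]
    have h3 := ENNReal.Tendsto.const_mul (a := 2) hlim (Or.inr (by norm_num))
    rw [mul_zero] at h3
    refine tendsto_of_tendsto_of_tendsto_of_le_of_le tendsto_const_nhds h3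
      (fun n => zero_le) fun n => ?_
    simp only
    rw [hu.mollifiedEnergy_sub (hρ n) haT htT, ← ofReal_norm,
      intervalIntegral.norm_integral_eq_norm_integral_uIoc, ofReal_norm]
    refine (enorm_integral_le_lintegral_enorm _).trans ?_
    simp only [enorm_mul]
    rw [lintegral_const_mul' _ _ (by simp)]
    have h2e : ‖(2 : ℝ)‖ₑ = 2 := by
      rw [← ofReal_norm]; simp
    rw [h2e]
    gcongr
    exact uIoc_subset_uIcc.trans (ordConnected_Ioo.uIcc_subset haT htT)
  exact sub_eq_zero.1 (tendsto_nhds_unique h1 h2)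

theorem isConservative_of_uniformMinkowskiContent_eq_zero (T : ℝ) (hT : 0 < T) (θ : ℝ)
    (hθ : θ ∈ Ioo (0 : ℝ) (1 / 3))
    (v : ℝ → E3 → E3) (hv : IsWeakEulerSolution T v)
    (hv_holder : MemL3Holder T θ v) (hv_cont : MemC0L2 T v)
    (S : ℝ → Set E3) (C : ℝ → ℝ) (hC : MemLp C 3 (volume.restrict (Ioo 0 T)))
    (κ : ℝ) (hκ : κ ≤ 1 - θ)
    (hS : ∀ᵐ t ∂(volume.restrict (Icc 0 T)),
      IsClosed (S t) ∧ IsPeriodicSet (S t) ∧ ContDiffOn ℝ 1 (v t) (S t)ᶜ ∧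
        ∀ x ∈ (S t)ᶜ, ‖fderiv ℝ (v t) x‖ ≤ C t * distTo x (S t) ^ (-κ))
    {s : ℝ} (hs : s < 2 + 3 * θ) (hzero : uniformMinkowskiContent T s S = 0) :
    IsConservative T v := by
  set u : ℝ → E3 → E3 := fun t => v (projIcc 0 T hT.le t) with hu_def
  have hu : IsEulerCurve T u := isEulerCurve_projIcc hT hv hv_cont
  have huv : ∀ t ∈ Icc 0 T, u t = v t := fun t ht => by
    simp only [hu_def, projIcc_of_mem hT.le ht]
  obtain ⟨m, hm, hmS⟩ := exists_forall_cthickening_le hzero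
  -- The condition `q < β`, that is `1 - 3θ < 3 - s`, is exactly `s < 2 + 3θ`: this is where the
  -- threshold enters.
  obtain ⟨M, hM, hMS⟩ := exists_lintegral_distTo_rpow_le (q := 1 - 3 * θ) (β := 3 - s)
    (by linarith [hθ.2]) (by linarith) hm
  have hv3 : ∫⁻ t in Ioo 0 T, holderENorm θ (v t) ^ 3 ≠ ∞ := by
    simpa using lintegral_enorm_pow_three_ne_top hv_holder
  have hv3m : AEMeasurable (fun t => holderENorm θ (v t) ^ 3) (volume.restrict (Ioo 0 T)) :=
    hv_holder.1.aemeasurable.pow_const 3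
  have hC3 := lintegral_enorm_pow_three_ne_top hC
  have hb : ∫⁻ t in Ioo 0 T, (holderENorm θ (v t) ^ 3 + ‖C t‖ₑ ^ 3) ≠ ∞ := by
    rw [lintegral_add_left' hv3m]
    exact ENNReal.add_ne_top.2 ⟨hv3, hC3⟩
  have hae : ae (volume.restrict (Ioo 0 T)) ≤ ae (volume.restrict (Icc 0 T)) :=
    ae_mono (Measure.restrict_mono Ioo_subset_Icc_self le_rfl)
  obtain ⟨E, hE⟩ := hu.energy_eq_of_isRegularOff hθ hb (fun t => ofReal_max_pow_le) hM (S := S) (by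
    filter_upwards [hS.filter_mono hae, hmS.filter_mono hae, ae_lt_top' hv3m hv3,
      ae_restrict_mem measurableSet_Ioo] with t h1 h2 h3 h4
    have ht := Ioo_subset_Icc_self h4
    rw [huv t ht]
    refine ⟨isRegularOff_of_bounds hθ.1.le hκ (hv.periodic t ht) (fun h => by simp [h] at h3)
      h1.1 h1.2.1 h1.2.2.1 h1.2.2.2,
      torusMeasure_eq_zero_of_cthickening_le (by linarith [hθ.2]) h2, hMS _ h2⟩)
  have hcont : Continuous fun t => ∫ x, ‖u t x‖ ^ 2 ∂torusMeasure := by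
    simp only [fun t => integral_norm_sq_eq (hu.memLp t)]
    exact hu.continuous_torusL2.pow 2
  -- Two continuous functions that agree almost everywhere on `[0,T]` agree at every point, end
  -- points included.
  have heq := Measure.eqOn_Icc_of_ae_eq volume hT.ne (f := fun t => ∫ x, ‖u t x‖ ^ 2 ∂torusMeasure)
    (g := fun _ => E) (by rwa [Measure.restrict_congr_set Ioo_ae_eq_Icc.symm])
    hcont.continuousOn continuousOn_const
  intro t ht
  have h0 : (0 : ℝ) ∈ Icc 0 T := ⟨le_rfl, hT.le⟩
  have e1 := heq ht
  have e2 := heq h0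
  simp only [huv t ht, huv 0 h0] at e1 e2
  rw [kineticEnergy, kineticEnergy, e1, e2]

theorem corollary1p2 (T : ℝ) (hT : 0 < T) (θ : ℝ) (hθ : θ ∈ Ioo (0 : ℝ) (1 / 3))
    (v : ℝ → E3 → E3) (hv : IsWeakEulerSolution T v)
    (hv_holder : MemL3Holder T θ v) (hv_cont : MemC0L2 T v)
    (hv_nc : ¬ IsConservative T v)
    (S : ℝ → Set E3) (C : ℝ → ℝ) (hC : MemLp C 3 (volume.restrict (Ioo 0 T)))
    (κ : ℝ) (hκ : κ ≤ 1 - θ)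
    (hS : ∀ᵐ t ∂(volume.restrict (Icc 0 T)),
      IsClosed (S t) ∧ IsPeriodicSet (S t) ∧ ContDiffOn ℝ 1 (v t) (S t)ᶜ ∧
        ∀ x ∈ (S t)ᶜ, ‖fderiv ℝ (v t) x‖ ≤ C t * distTo x (S t) ^ (-κ)) :
    ENNReal.ofReal (2 + 3 * θ) ≤ uniformMinkowskiDim T S := by
  refine le_iInf₂ fun s hs => ?_
  by_contra hlt
  rw [not_le] at hlt
  refine hv_nc (isConservative_of_uniformMinkowskiContent_eq_zero T hT θ hθ v hv hv_holder hv_cont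
    S C hC κ hκ hS (s := s) ?_ hs)
  rwa [← ENNReal.ofReal_coe_nnreal, ENNReal.ofReal_lt_ofReal_iff (by linarith [hθ.1])] at hlt
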